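/- **Theorem 4 (Vulnerability of Short Tails).** Consider a proof-of-work blockchain with instantaneous communication, in which the honest nodes and the adversary mine according to independent Poisson processes of rates $\lambda_h>0$ and $\lambda_a$, each block having an independent uniform (normalised) hash. Honest nodes mine on the tip of their chain $\mathcal C_t$ and adopt any longer chain that is broadcast; the adversary may mine on any block, keep its blocks secret, and broadcast them whenever it likes. Honest nodes run a trimming protocol: each complete chain $\mathcal C$ of $B$ blocks (indices $0,\dots,B-1$) is turned into a trimmed chain $\mathcal P(\mathcal C)$, a subset of its blocks, with a trimming point $B'\in\{0,\dots,B-1\}$, which contains the genesis block and all blocks with index at least $B'$ (the untrimmed tail, of length $B-B'$). The system is *trim-attacked* if at some time there is a chain $\mathcal D$, formed from blocks mined so far, that is longer than the honest chain $\mathcal C$ and such that the last common block of $\mathcal P(\mathcal C)$ and $\mathcal P(\mathcal D)$ has index smaller than the trimming point of $\mathcal P(\mathcal C)$. Let $B_t$ and $B'_t$ be the length and the trimming point of the honest chain at time $t$ when no adversarial block has been adopted. Suppose that there are $\epsilon>0$ and a function $h$ with $h(B)=o(\log B)$ such that, whatever the first blocks of the chain are, the tail has length at most $h(B_t)$ with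 probability more than $\epsilon$ at all late times $t$; that is, for every $n$ and every event $A$ of positive probability about the hashes of the first $n$ blocks mined, $$\Pr\bigl(B_t-B'_t\le h(B_t)\,\big|\,A\bigr)>\epsilon\qquad\text{for all sufficiently large } t.$$ Then there are a mining power $0<\lambda_a<\lambda_h$ and a strategy of an adversary of this mining power (which sees only the past) such that $\Pr(\text{trim-attacked})=1$. -/

import Mathlib

open MeasureTheory ProbabilityTheory Filter Asymptotics

namespace HybridNode

/-! ### Blocks, chains and trimmed chains -/

/-- A mined block is identified with its normalised hash, a number in `[0, 1]`
(a block of hash `u` is a level-`μ` superblock iff `u ≤ 2 ^ (-μ)`). -/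
abbrev Block : Type := unitInterval

/-- A chain is the list of its blocks after the genesis block, from the oldest to the newest.
The genesis block has index `0`, and the entry number `i` of the list is the block of index
`i + 1`. -/
abbrev Chain : Type := List Block

/-- The chain-length `B`: the number of blocks, the genesis block included. -/
def Chain.size (C : Chain) : ℕ := C.length + 1

/-- A trimmed chain: an underlying complete chain, the set of (indices of) the blocks which are
retained, and the trimming point `B'`, the index of a block of the chain. The genesis block and
all blocks from the trimming point on are retained. -/
structure TrimmedChain where
  chain : Chain
  retained : Finset ℕ
  trimPoint : ℕ
  retained_lt : ∀ i ∈ retained, i < chain.size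
  genesis_mem : 0 ∈ retained
  trimPoint_lt : trimPoint < chain.size
  untrimmed_tail : ∀ i, trimPoint ≤ i → i < chain.size → i ∈ retained

/-- The length `B - B'` of the untrimmed tail. -/
def TrimmedChain.tailLength (P : TrimmedChain) : ℕ := P.chain.size - P.trimPoint

open Classical in
/-- The latest common ancestor: the last block that both trimmed chains retain. A block commits to
all its ancestors, so the blocks of index `i` of two chains are the same block iff the two chains
agree up to the index `i`. -/
noncomputable def lca (P Q : TrimmedChain) : ℕ :=
  ((P.retained ∩ Q.retained).filter fun i => P.chain.take i = Q.chain.take i).sup id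

/-- The comparison of the trimmed chain `P` of an honest node with another trimmed chain `Q`:
`Q` is declared the winner iff its underlying chain is strictly longer. -/
def compare (P Q : TrimmedChain) : TrimmedChain :=
  if P.chain.size < Q.chain.size then Q else P

/-- A trimming protocol: a rule which turns every complete chain into a trimmed chain. -/
structure TrimmingProtocol where
  trim : Chain → TrimmedChain
  chain_trim : ∀ C, (trim C).chain = C
  measurable_trimPoint : ∀ n : ℕ,
    Measurable fun x : Fin n → Block => (trim (List.ofFn x)).trimPoint

/-! ### Mining -/

/-- The sample space of one mining process: for the block number `i = 0, 1, 2, …` of the process,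
the time elapsed since the previous block (or since time `0`) and the hash of the block. -/
abbrev Mining : Type := ℕ → ℝ × Block

/-- The law of a Poisson mining process of rate `r`: independent interarrival times that are
exponential of rate `r`, and independent hashes that are uniform on `[0, 1]`. -/
noncomputable def miningLaw (r : ℝ) : Measure Mining :=
  Measure.infinitePi fun _ => (expMeasure r).prod volume

theorem isProbabilityMeasure_miningLaw {r : ℝ} (hr : 0 < r) :
    IsProbabilityMeasure (miningLaw r) := by
  have := isProbabilityMeasure_expMeasure hr
  unfold miningLaw
  infer_instance

/-- The time at which block number `n` of the process is mined. -/
def arrival (ξ : Mining) (n : ℕ) : ℝ := ∑ i ∈ Finset.range (n + 1), (ξ i).1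

/-- The number of blocks mined up to time `t`. -/
noncomputable def count (ξ : Mining) (t : ℝ) : ℕ := {n | arrival ξ n ≤ t}.ncard

/-- The chain of the honest nodes at time `t` as long as they adopt no block of an adversary. -/
noncomputable def honestChain (ξ : Mining) (t : ℝ) : Chain :=
  List.ofFn fun i : Fin (count ξ t) => (ξ i).2

/-! ### The execution in the presence of an adversary -/

/-- The record of a mined block: the time, the miner, and the chain that ends in the block. -/
structure MinedBlock where
  time : ℝ
  byAdversary : Bool
  chain : Chain

/-- The state of the system, as the adversary sees it: the numbers of blocks that the honest nodes
and the adversary have mined so far, the chain of the honest nodes, and the records of all mined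
blocks, the newest first. -/
structure State where
  honestMined : ℕ
  advMined : ℕ
  chain : Chain
  history : List MinedBlock

/-- The complete chains that can be formed from the blocks mined so far (secret ones included):
the genesis chain, and the chain that ends in `b` for every mined block `b`. -/
def State.tree (s : State) : Set Chain := {D | D = [] ∨ ∃ b ∈ s.history, b.chain = D}

/-- The initial state: only the genesis block exists. -/
def State.init : State := ⟨0, 0, [], []⟩

/-- A strategy of the adversary: at every stage, it selects from the present state the chain to
which its next block is added, and a chain to be broadcast. -/
structure Strategy where
  parent : State → Chain
  broadcast : State → Chain

open Classical in
/-- One block is mined, by whoever finds the next one first. The honest nodes add it to the tip of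
their chain; the adversary adds it to any chain of its choice. -/
noncomputable def mine (σ : Strategy) (ξ ζ : Mining) (s : State) : State :=
  if arrival ξ s.honestMined < arrival ζ s.advMined then
    let D := s.chain ++ [(ξ s.honestMined).2]
    { honestMined := s.honestMined + 1
      advMined := s.advMined
      chain := D
      history := ⟨arrival ξ s.honestMined, false, D⟩ :: s.history }
  else
    let D := (if σ.parent s ∈ s.tree then σ.parent s else s.chain) ++ [(ζ s.advMined).2]
    { honestMined := s.honestMined
      advMined := s.advMined + 1
      chain := s.chain
      history := ⟨arrival ζ s.advMined, true, D⟩ :: s.history }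

open Classical in
/-- The adversary broadcasts the chain of its choice, among those whose blocks have been mined;
the honest nodes adopt it if it is longer than theirs. (To broadcast nothing is to select the
chain of the honest nodes.) -/
noncomputable def deliver (σ : Strategy) (s : State) : State :=
  if σ.broadcast s ∈ s.tree ∧ s.chain.size < (σ.broadcast s).size then
    { s with chain := σ.broadcast s }
  else s

/-- The state once `n` blocks have been mined, after the adversary's broadcast. The honest blocks
have the arrival times and hashes `ξ`, those of the adversary `ζ`. -/
noncomputable def run (σ : Strategy) (ξ ζ : Mining) : ℕ → State
  | 0 => State.init
  | n + 1 => deliver σ (mine σ ξ ζ (run σ ξ ζ n))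

/-- In the state `s`, the adversary has a chain `D` whose trimmed chain is declared longer than
that of the honest nodes, while the latest common ancestor of the two precedes the trimming point
of the honest nodes. -/
def AttackedIn (T : TrimmingProtocol) (s : State) : Prop :=
  ∃ D ∈ s.tree, lca (T.trim s.chain) (T.trim D) < (T.trim s.chain).trimPoint ∧
    compare (T.trim s.chain) (T.trim D) = T.trim D

/-- The outcome `(ξ, ζ)` is trim-attacked: there is a time at which an attack is present. The state
changes only when a block is mined, and then at once again by the broadcast that follows, so that
all states of the execution are the ones below. -/
def TrimAttacked (T : TrimmingProtocol) (σ : Strategy) (ξ ζ : Mining) : Prop :=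
  ∃ n, AttackedIn T (run σ ξ ζ n) ∨ AttackedIn T (mine σ ξ ζ (run σ ξ ζ n))

/-! ### Short tails -/

/-- The event that the untrimmed tail at time `t` is at most `h (B_t)`. -/
def shortTail (T : TrimmingProtocol) (h : ℕ → ℝ) (t : ℝ) : Set Mining :=
  {ξ | ((T.trim (honestChain ξ t)).tailLength : ℝ) ≤ h (honestChain ξ t).size}

/-- The event that the first `n` honest blocks have the property `S`. -/
def beginsIn {n : ℕ} (S : Set (Fin n → Block)) : Set Mining :=
  {ξ | (fun i : Fin n => (ξ i).2) ∈ S}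

/-- With probability more than `ε`, whatever the first blocks of the chain are, the untrimmed tail
has length at most `h (B_t)` at all late times `t`. -/
def HasShortTails (T : TrimmingProtocol) (r ε : ℝ) (h : ℕ → ℝ) : Prop :=
  ∀ (n : ℕ) (S : Set (Fin n → Block)), MeasurableSet S → miningLaw r (beginsIn S) ≠ 0 →
    ∀ᶠ t : ℝ in atTop, ε < ((miningLaw r)[|beginsIn S]).real (shortTail T h t)

end HybridNode

/-! After every honest block the adversary starts a secret fork whose first block competes with the
block at the trimming point. If the honest chain consists of `m` blocks after genesis and its tail
has length at most `h (m + 1)`, then `k m = ⌊h (m + 1)⌋₊ + 1` adversary blocks mined before the next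
honest one make the fork longer than the honest chain (`trimAttacked_of_run`). By memorylessness
such a run has probability `q ^ k m` with `q = lamA / (lamH + lamA)`, and `h = o(log)` makes this at
least `q * (m + 1) ^ (-1/4)` for large `m`.

The honest hashes are independent of all mining times, so they may be frozen. `ae_exists_run` is
then a second Borel–Cantelli lemma: if the sum of `q ^ k m` over a set of `m` diverges, some `m` in
the set is followed by its run. What remains is that this sum, over the `m` with a short tail,
diverges for almost every hash sequence (`ae_not_summable_shortAt`).

If it did not, the partial sums would be bounded by some `K` on an event `E` of positive
probability. The hypothesis only speaks of events about finitely many hashes, but these approximate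
`E`, so the probability of `E` together with a short tail at time `t` stays above some `c > 0` at
all late `t` (`lt_measure_shortTail_inter`). On the other hand, let `a m` be the probability of `E`
together with a short tail at `m` blocks. The bound `K` on the weighted sum of the `a m` gives `∑ m
< N², a m = O(√N)`. Integrated over the times up to `N`, each `m` contributes at most `a m` times
the mean interarrival time, while `N²` blocks are reached by time `N` only with vanishing
probability. So the time integral is `o(N)` (`not_eventually_le_of_sojourn_bound`), which
contradicts the lower bound `c`. -/

namespace HybridNode

/-! ### Infinite product measures -/

/-- The sequence with first entry `a` which continues as `x`. -/
def consSeq {α : Type*} (a : α) (x : ℕ → α) : ℕ → α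
  | 0 => a
  | n + 1 => x n

@[simp] theorem consSeq_zero {α : Type*} (a : α) (x : ℕ → α) : consSeq a x 0 = a := rfl

@[simp] theorem consSeq_succ {α : Type*} (a : α) (x : ℕ → α) (n : ℕ) : consSeq a x (n + 1) = x n := rfl

section Product

variable {α β : Type*} [MeasurableSpace α] [MeasurableSpace β]

theorem generateFrom_pi_measurableSet (α : Type*) [MeasurableSpace α] :
    MeasurableSpace.generateFrom
      (squareCylinders fun _ : ℕ => {s : Set α | MeasurableSet s}) = MeasurableSpace.pi :=
  generateFrom_squareCylinders

theorem univ_mem_squareCylinders (α : Type*) [MeasurableSpace α] :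
    Set.univ ∈ squareCylinders fun _ : ℕ => {s : Set α | MeasurableSet s} :=
  ⟨∅, fun _ => Set.univ, by simp, by simp⟩

/-- The first and the second components of a sequence of independent pairs, whose components
are independent, are independent. -/
theorem infinitePi_prod_map_unzip (μ : Measure α) (ν : Measure β) [IsProbabilityMeasure μ]
    [IsProbabilityMeasure ν] :
    (Measure.infinitePi fun _ : ℕ => μ.prod ν).map
        (fun ξ => (fun i => (ξ i).1, fun i => (ξ i).2)) =
      (Measure.infinitePi fun _ : ℕ => μ).prod (Measure.infinitePi fun _ : ℕ => ν) := by
  symm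
  refine Measure.prod_eq_generateFrom (generateFrom_pi_measurableSet α)
    (generateFrom_pi_measurableSet β)
    (isPiSystem_squareCylinders (fun _ => MeasurableSpace.isPiSystem_measurableSet)
      fun _ => MeasurableSet.univ)
    (isPiSystem_squareCylinders (fun _ => MeasurableSpace.isPiSystem_measurableSet)
      fun _ => MeasurableSet.univ)
    ⟨fun _ => Set.univ, fun _ => univ_mem_squareCylinders α, by simp, by simp [Set.iUnion_const]⟩
    ⟨fun _ => Set.univ, fun _ => univ_mem_squareCylinders β, by simp, by simp [Set.iUnion_const]⟩ ?_
  rintro _ ⟨s, t, ht, rfl⟩ _ ⟨s', t', ht', rfl⟩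
  simp only [Set.mem_pi, Set.mem_univ, forall_const, Set.mem_ofPred_eq] at ht ht'
  classical
  have hm : Measurable fun ξ : ℕ → α × β => (fun i => (ξ i).1, fun i => (ξ i).2) := by fun_prop
  have hst : MeasurableSet ((s : Set ℕ).pi t) :=
    MeasurableSet.pi s.countable_toSet fun i _ => ht i
  have hst' : MeasurableSet ((s' : Set ℕ).pi t') :=
    MeasurableSet.pi s'.countable_toSet fun i _ => ht' i
  rw [Measure.map_apply hm (hst.prod hst'), Measure.infinitePi_pi _ fun i _ => ht i,
    Measure.infinitePi_pi _ fun i _ => ht' i]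
  -- Padding with `univ` puts both cylinders over the common index set `s ∪ s'`, where the law of
  -- the pairs factorises entry by entry.
  let v : ℕ → Set α := fun i => if i ∈ s then t i else Set.univ
  let v' : ℕ → Set β := fun i => if i ∈ s' then t' i else Set.univ
  have hv : ∀ i, MeasurableSet (v i) := fun i => by
    by_cases hi : i ∈ s <;> simp [v, hi, ht i]
  have hv' : ∀ i, MeasurableSet (v' i) := fun i => by
    by_cases hi : i ∈ s' <;> simp [v', hi, ht' i]
  have hpre : (fun ξ : ℕ → α × β => ((fun i => (ξ i).1, fun i => (ξ i).2) : (ℕ → α) × (ℕ → β))) ⁻¹'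
      (((s : Set ℕ).pi t) ×ˢ ((s' : Set ℕ).pi t')) =
      ((s ∪ s' : Finset ℕ) : Set ℕ).pi fun i => v i ×ˢ v' i := by
    ext ξ
    simp only [Set.mem_preimage, Set.mem_prod, Set.mem_pi, Finset.mem_coe, Finset.mem_union]
    constructor
    · rintro ⟨h1, h2⟩ i -
      constructor
      · by_cases hi : i ∈ s <;> simp [v, hi]
        exact h1 i hi
      · by_cases hi : i ∈ s' <;> simp [v', hi]
        exact h2 i hi
    · intro H
      constructor
      · intro i hi
        simpa [v, hi] using (H i (Or.inl hi)).1
      · intro i hi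
        simpa [v', hi] using (H i (Or.inr hi)).2
  rw [hpre, Measure.infinitePi_pi _ fun i _ => (hv i).prod (hv' i)]
  simp_rw [Measure.prod_prod]
  rw [Finset.prod_mul_distrib]
  congr 1
  · rw [← Finset.prod_subset (Finset.subset_union_left (s₁ := s) (s₂ := s'))]
    · exact Finset.prod_congr rfl fun i hi => by simp [v, hi]
    · intro i _ hi
      simp [v, hi]
  · rw [← Finset.prod_subset (Finset.subset_union_right (s₁ := s) (s₂ := s'))]
    · exact Finset.prod_congr rfl fun i hi => by simp [v', hi]
    · intro i _ hi
      simp [v', hi]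

theorem measurable_consSeq : Measurable fun p : α × (ℕ → α) => consSeq p.1 p.2 := by
  refine measurable_pi_lambda _ fun n => ?_
  cases n with
  | zero => exact measurable_fst
  | succ n => exact (measurable_pi_apply n).comp measurable_snd

/-- Lets the first interarrival time be split off from an independent remainder, as the Markov
property at the first arrival requires. -/
theorem infinitePi_map_consSeq (ν : Measure α) [IsProbabilityMeasure ν] :
    (ν.prod (Measure.infinitePi fun _ : ℕ => ν)).map (fun p => consSeq p.1 p.2) =
      Measure.infinitePi fun _ : ℕ => ν := by
  refine Measure.eq_infinitePi _ fun s t ht => ?_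
  classical
  let v : ℕ → Set α := fun i => if i ∈ s then t i else Set.univ
  have hv : ∀ i, MeasurableSet (v i) := fun i => by
    by_cases hi : i ∈ s <;> simp [v, hi, ht i]
  obtain ⟨N, hN⟩ : ∃ N, s ⊆ Finset.range (N + 1) :=
    ⟨s.sup id, fun i hi => Finset.mem_range.2 (Nat.lt_succ_of_le (Finset.le_sup (f := id) hi))⟩
  rw [Measure.map_apply measurable_consSeq (MeasurableSet.pi s.countable_toSet fun i _ => ht i)]
  have hpre : (fun p : α × (ℕ → α) => consSeq p.1 p.2) ⁻¹' ((s : Set ℕ).pi t) =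
      v 0 ×ˢ ((Finset.range N : Finset ℕ) : Set ℕ).pi fun i => v (i + 1) := by
    ext ⟨a, x⟩
    simp only [Set.mem_preimage, Set.mem_prod, Set.mem_pi, Finset.mem_coe]
    constructor
    · intro H
      refine ⟨?_, fun i _ => ?_⟩
      · by_cases hi : 0 ∈ s <;> simp [v, hi]
        exact H 0 hi
      · by_cases hi : i + 1 ∈ s <;> simp [v, hi]
        exact H (i + 1) hi
    · rintro ⟨h0, h1⟩ i hi
      cases i with
      | zero => simpa [v, hi] using h0
      | succ i =>
        have := Finset.mem_range.1 (hN hi)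
        simpa [v, hi] using h1 i (Finset.mem_range.2 (by omega))
  rw [hpre, Measure.prod_prod, Measure.infinitePi_pi _ fun i _ => hv (i + 1), mul_comm,
    ← Finset.prod_range_succ' (fun i => ν (v i)), ← Finset.prod_subset hN]
  · exact Finset.prod_congr rfl fun i hi => by simp [v, hi]
  · intro i _ hi
    simp [v, hi]

end Product

/-! ### The exponential distribution -/

section Exponential

open scoped ENNReal

theorem lintegral_expMeasure (r : ℝ) {f : ℝ → ℝ≥0∞} (hf : Measurable f) :
    ∫⁻ x, f x ∂(expMeasure r) = ∫⁻ x in Set.Ioi 0, ENNReal.ofReal (r * Real.exp (-(r * x))) * f x := by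
  have hm : Measurable (exponentialPDF r) := (measurable_exponentialPDFReal r).ennreal_ofReal
  change ∫⁻ x, f x ∂(volume.withDensity (exponentialPDF r)) = _
  rw [lintegral_withDensity_eq_lintegral_mul _ hm hf, ← setLIntegral_congr Ioi_ae_eq_Ici.symm,
    ← lintegral_indicator measurableSet_Ici]
  refine lintegral_congr fun x => ?_
  by_cases hx : 0 ≤ x
  · simp [Set.indicator, hx, exponentialPDF_eq]
  · simp [Set.indicator, hx, exponentialPDF_eq]

instance nullSingletonClass_expMeasure (r : ℝ) : NullSingletonClass (expMeasure r) := by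
  change NullSingletonClass (volume.withDensity (exponentialPDF r))
  infer_instance

theorem ae_pos_expMeasure (r : ℝ) : ∀ᵐ x ∂(expMeasure r), 0 < x := by
  have : ∫⁻ x, (Set.Iic (0 : ℝ)).indicator 1 x ∂(expMeasure r) = 0 := by
    rw [lintegral_expMeasure r (measurable_one.indicator measurableSet_Iic)]
    rw [setLIntegral_congr_fun (g := 0) measurableSet_Ioi]
    · simp
    · intro x hx
      have : ¬ x ≤ 0 := not_le.2 hx
      simp [this]
  rw [lintegral_indicator_one measurableSet_Iic] at this
  rw [ae_iff]
  simpa [Set.Iic] using this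

/-- Memorylessness. -/
theorem lintegral_expMeasure_residual (r : ℝ) {u : ℝ} (hu : 0 ≤ u) {f : ℝ → ℝ≥0∞}
    (hf : Measurable f) :
    ∫⁻ v, (Set.Ioi u).indicator (fun v => f (v - u)) v ∂(expMeasure r) =
      ENNReal.ofReal (Real.exp (-(r * u))) * ∫⁻ v, f v ∂(expMeasure r) := by
  rw [lintegral_expMeasure r (by exact (hf.comp (measurable_id.sub_const u)).indicator measurableSet_Ioi),
    lintegral_expMeasure r hf, ← lintegral_const_mul _ (by fun_prop),
    ← lintegral_indicator measurableSet_Ioi, ← lintegral_indicator measurableSet_Ioi,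
    ← lintegral_sub_right_eq_self ((Set.Ioi (0 : ℝ)).indicator fun v =>
      ENNReal.ofReal (Real.exp (-(r * u))) * (ENNReal.ofReal (r * Real.exp (-(r * v))) * f v)) u]
  refine lintegral_congr fun v => ?_
  by_cases hv : u < v
  · have h0 : 0 < v := hu.trans_lt hv
    have h1 : 0 < v - u := sub_pos.2 hv
    simp only [Set.indicator, Set.mem_Ioi, hv, h0, h1, if_true]
    rw [← mul_assoc, ← ENNReal.ofReal_mul (Real.exp_pos _).le]
    congr 2
    rw [mul_left_comm, ← Real.exp_add]
    ring_nf
  · have h1 : ¬ 0 < v - u := by rwa [sub_pos]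
    simp [Set.indicator, hv, h1]

theorem lintegral_exp_neg_expMeasure {r s : ℝ} (hr : 0 < r) (hs : 0 < s) :
    ∫⁻ u, ENNReal.ofReal (Real.exp (-(s * u))) ∂(expMeasure r) = ENNReal.ofReal (r / (r + s)) := by
  have hrs : 0 < r + s := by positivity
  rw [lintegral_expMeasure r (by fun_prop)]
  have h1 : ∫⁻ x in Set.Ioi 0, ENNReal.ofReal ((r + s) * Real.exp (-((r + s) * x))) * 1 = 1 := by
    rw [← lintegral_expMeasure (r + s) (f := fun _ => 1) measurable_const]
    have := isProbabilityMeasure_expMeasure hrs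
    simp
  rw [← mul_one (ENNReal.ofReal (r / (r + s))), ← h1, ← lintegral_const_mul _ (by fun_prop)]
  refine lintegral_congr fun x => ?_
  rw [mul_one, ← ENNReal.ofReal_mul (by positivity), ← ENNReal.ofReal_mul (by positivity)]
  congr 1
  rw [mul_assoc, ← Real.exp_add, ← mul_assoc, div_mul_cancel₀ _ hrs.ne']
  ring_nf

theorem integrable_expMeasure {r : ℝ} (hr : 0 < r) : Integrable id (expMeasure r) := by
  refine ⟨by fun_prop, ?_⟩
  rw [HasFiniteIntegral]
  rw [lintegral_expMeasure r (by fun_prop)]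
  have h := integrableOn_rpow_mul_exp_neg_mul_rpow (p := 1) (s := 1) (b := r) (by norm_num)
    (by norm_num) hr
  have h2 := (h.const_mul r).2
  rw [HasFiniteIntegral] at h2
  refine lt_of_le_of_lt (le_of_eq ?_) h2
  refine setLIntegral_congr_fun measurableSet_Ioi fun x hx => ?_
  have hx : 0 < x := hx
  simp only [id, Real.rpow_one, Real.enorm_eq_ofReal hx.le]
  rw [Real.enorm_eq_ofReal (by positivity), ← ENNReal.ofReal_mul (by positivity)]
  congr 1
  ring_nf

end Exponential

/-! ### The race of two renewal processes -/

section Race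

open scoped ENNReal

/-- The time of arrival number `n`, for the interarrival times `x`. -/
def arrivalTime (x : ℕ → ℝ) (n : ℕ) : ℝ := ∑ i ∈ Finset.range (n + 1), x i

theorem arrivalTime_tail (x : ℕ → ℝ) (n : ℕ) :
    arrivalTime (fun i => x (i + 1)) n = arrivalTime x (n + 1) - x 0 := by
  simp [arrivalTime, Finset.sum_range_succ' x (n + 1)]

theorem arrivalTime_consSeq_sub (x : ℕ → ℝ) (c : ℝ) (n : ℕ) :
    arrivalTime (consSeq (x 0 - c) fun i => x (i + 1)) n = arrivalTime x n - c := by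
  simp [arrivalTime, Finset.sum_range_succ' _ n]
  ring

/-- The residual interarrival times after the first arrival in either process. -/
noncomputable def raceStep (p : (ℕ → ℝ) × (ℕ → ℝ)) : (ℕ → ℝ) × (ℕ → ℝ) :=
  if p.1 0 < p.2 0 then (fun i => p.1 (i + 1), consSeq (p.2 0 - p.1 0) fun i => p.2 (i + 1))
  else (consSeq (p.1 0 - p.2 0) fun i => p.1 (i + 1), fun i => p.2 (i + 1))

/-- The number of arrivals of the first process among the first `n` arrivals of both. -/
noncomputable def firstCount : ℕ → (ℕ → ℝ) × (ℕ → ℝ) → ℕ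
  | 0, _ => 0
  | n + 1, p => (if p.1 0 < p.2 0 then 1 else 0) + firstCount n (raceStep p)

theorem firstCount_le (n : ℕ) (p : (ℕ → ℝ) × (ℕ → ℝ)) : firstCount n p ≤ n := by
  induction n generalizing p with
  | zero => exact le_rfl
  | succ n ih =>
    have := ih (raceStep p)
    unfold firstCount
    split_ifs <;> omega

theorem firstCount_succ_of_lt {p : (ℕ → ℝ) × (ℕ → ℝ)} (h : p.1 0 < p.2 0) (n : ℕ) :
    firstCount (n + 1) p = firstCount n (raceStep p) + 1 := by
  simp [firstCount, h, add_comm]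

theorem firstCount_succ_of_not_lt {p : (ℕ → ℝ) × (ℕ → ℝ)} (h : ¬ p.1 0 < p.2 0) (n : ℕ) :
    firstCount (n + 1) p = firstCount n (raceStep p) := by
  simp only [firstCount, h, if_false, zero_add]

/-- The recursive definition peels off the first arrival, which suits one-step analysis; this form
appends the last one and is the comparison made by `mine`. They agree because `raceStep` shifts all
remaining arrival times by the same amount. -/
theorem firstCount_succ (n : ℕ) (p : (ℕ → ℝ) × (ℕ → ℝ)) :
    firstCount (n + 1) p = firstCount n p +
      if arrivalTime p.1 (firstCount n p) < arrivalTime p.2 (n - firstCount n p) then 1 else 0 := by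
  induction n generalizing p with
  | zero => simp [firstCount, arrivalTime]
  | succ n ih =>
    have hle := firstCount_le n (raceStep p)
    by_cases h : p.1 0 < p.2 0
    · rw [firstCount_succ_of_lt h, firstCount_succ_of_lt h, ih]
      have h1 : n + 1 - (firstCount n (raceStep p) + 1) = n - firstCount n (raceStep p) := by omega
      rw [h1, add_right_comm]
      congr 2
      simp only [raceStep, h, if_true]
      rw [arrivalTime_tail, arrivalTime_consSeq_sub, sub_lt_sub_iff_right]
    · rw [firstCount_succ_of_not_lt h, firstCount_succ_of_not_lt h, ih]
      have h1 : n + 1 - firstCount n (raceStep p) = n - firstCount n (raceStep p) + 1 := by omega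
      rw [h1]
      congr 2
      simp only [raceStep, h, if_false]
      rw [arrivalTime_tail, arrivalTime_consSeq_sub, sub_lt_sub_iff_right]

theorem monotone_firstCount (p : (ℕ → ℝ) × (ℕ → ℝ)) : Monotone fun n => firstCount n p :=
  monotone_nat_of_le_succ fun n => by rw [firstCount_succ]; exact Nat.le_add_right _ _

theorem measurable_consSeq_tail {Ω : Type*} [MeasurableSpace Ω] {f : Ω → ℝ} {g : Ω → ℕ → ℝ}
    (hf : Measurable f) (hg : Measurable g) : Measurable fun ω => consSeq (f ω) (g ω) :=
  measurable_consSeq.comp (hf.prodMk hg)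

theorem measurableSet_first_lt :
    MeasurableSet {p : (ℕ → ℝ) × (ℕ → ℝ) | p.1 0 < p.2 0} :=
  measurableSet_lt (by fun_prop) (by fun_prop)

theorem measurable_residual :
    Measurable fun p : (ℕ → ℝ) × (ℕ → ℝ) =>
      ((fun i => p.1 (i + 1), consSeq (p.2 0 - p.1 0) fun i => p.2 (i + 1)) :
        (ℕ → ℝ) × (ℕ → ℝ)) :=
  Measurable.prodMk (by fun_prop) (measurable_consSeq_tail (by fun_prop) (by fun_prop))

theorem measurable_raceStep : Measurable raceStep :=
  Measurable.ite measurableSet_first_lt measurable_residual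
    (Measurable.prodMk (measurable_consSeq_tail (by fun_prop) (by fun_prop)) (by fun_prop))

theorem measurable_firstCount (n : ℕ) : Measurable (firstCount n) := by
  induction n with
  | zero => exact measurable_const
  | succ n ih =>
    exact (Measurable.ite measurableSet_first_lt measurable_const measurable_const).add
      (ih.comp measurable_raceStep)

/-! ### One-step analysis of the race -/

/-- The law of the interarrival times of two independent Poisson processes. -/
noncomputable def raceLaw (r s : ℝ) : Measure ((ℕ → ℝ) × (ℕ → ℝ)) :=
  (Measure.infinitePi fun _ : ℕ => expMeasure r).prod (Measure.infinitePi fun _ : ℕ => expMeasure s)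

theorem isProbabilityMeasure_raceLaw {r s : ℝ} (hr : 0 < r) (hs : 0 < s) :
    IsProbabilityMeasure (raceLaw r s) := by
  have := isProbabilityMeasure_expMeasure hr
  have := isProbabilityMeasure_expMeasure hs
  unfold raceLaw
  infer_instance

theorem raceLaw_swap {r s : ℝ} (hr : 0 < r) (hs : 0 < s) :
    (raceLaw r s).map Prod.swap = raceLaw s r := by
  have := isProbabilityMeasure_expMeasure hr
  have := isProbabilityMeasure_expMeasure hs
  exact Measure.prod_swap

theorem raceLaw_tie {r s : ℝ} (hr : 0 < r) (hs : 0 < s) :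
    raceLaw r s {p | p.1 0 = p.2 0} = 0 := by
  have := isProbabilityMeasure_expMeasure hr
  have := isProbabilityMeasure_expMeasure hs
  unfold raceLaw
  rw [Measure.measure_prod_null (measurableSet_eq_fun (by fun_prop) (by fun_prop))]
  refine ae_of_all _ fun x => ?_
  have h := (measurePreserving_eval_infinitePi (fun _ : ℕ => expMeasure s) 0).measure_preimage
    (measurableSet_singleton (x 0)).nullMeasurableSet
  rw [measure_singleton] at h
  convert! h using 2
  ext y
  simp [eq_comm]

/-- The strong Markov property at the first arrival, when it is one of the first process. -/
theorem raceLaw_first_lt {r s : ℝ} (hr : 0 < r) (hs : 0 < s) {A : Set ((ℕ → ℝ) × (ℕ → ℝ))}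
    (hA : MeasurableSet A) :
    raceLaw r s {p | p.1 0 < p.2 0 ∧
        ((fun i => p.1 (i + 1), consSeq (p.2 0 - p.1 0) fun i => p.2 (i + 1)) :
          (ℕ → ℝ) × (ℕ → ℝ)) ∈ A} =
      ENNReal.ofReal (r / (r + s)) * raceLaw r s A := by
  have := isProbabilityMeasure_expMeasure hr
  have := isProbabilityMeasure_expMeasure hs
  set X := Measure.infinitePi fun _ : ℕ => expMeasure r with hX
  set Y := Measure.infinitePi fun _ : ℕ => expMeasure s with hY
  have hXc : ((expMeasure r).prod X).map (fun p => consSeq p.1 p.2) = X :=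
    infinitePi_map_consSeq _
  have hYc : ((expMeasure s).prod Y).map (fun p => consSeq p.1 p.2) = Y :=
    infinitePi_map_consSeq _
  have hlaw : raceLaw r s = (((expMeasure r).prod X).prod ((expMeasure s).prod Y)).map
      (Prod.map (fun p => consSeq p.1 p.2) fun p => consSeq p.1 p.2) := by
    rw [← Measure.map_prod_map _ _ measurable_consSeq measurable_consSeq, hXc, hYc]
    rfl
  have hmeas : MeasurableSet {p : (ℕ → ℝ) × (ℕ → ℝ) | p.1 0 < p.2 0 ∧
        ((fun i => p.1 (i + 1), consSeq (p.2 0 - p.1 0) fun i => p.2 (i + 1)) :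
          (ℕ → ℝ) × (ℕ → ℝ)) ∈ A} :=
    measurableSet_first_lt.inter (measurable_residual hA)
  have hcm : Measurable (Prod.map (fun p : ℝ × (ℕ → ℝ) => consSeq p.1 p.2)
      fun p : ℝ × (ℕ → ℝ) => consSeq p.1 p.2) :=
    measurable_consSeq.prodMap measurable_consSeq
  have hright : raceLaw r s A = ∫⁻ x, Y {y | (x, y) ∈ A} ∂X := by
    unfold raceLaw
    rw [Measure.prod_apply hA]
    rfl
  have hsec : ∀ x, Y {y | (x, y) ∈ A} =
      ∫⁻ y, ∫⁻ b, A.indicator 1 (x, consSeq b y) ∂(expMeasure s) ∂Y := fun x => by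
    have hAx : MeasurableSet {y | (x, y) ∈ A} := measurable_prodMk_left hA
    have hm : Measurable fun p : ℝ × (ℕ → ℝ) =>
        A.indicator (1 : (ℕ → ℝ) × (ℕ → ℝ) → ℝ≥0∞) (x, consSeq p.1 p.2) :=
      (measurable_one.indicator hA).comp (measurable_const.prodMk measurable_consSeq)
    rw [← lintegral_prod_symm _ hm.aemeasurable]
    nth_rw 1 [← hYc]
    rw [Measure.map_apply measurable_consSeq hAx, ← lintegral_indicator_one
      (measurable_consSeq hAx)]
    rfl
  have hG : Measurable fun x => Y {y | (x, y) ∈ A} := measurable_measure_prodMk_left hA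
  rw [hright]
  nth_rw 1 [hlaw]
  rw [Measure.map_apply hcm hmeas, ← lintegral_indicator_one (hcm hmeas),
    lintegral_prod _ (measurable_one.indicator (hcm hmeas)).aemeasurable]
  -- With the first process frozen, the other one has no arrival before `p.1` with probability `exp
  -- (-(s * p.1))`, and its residual waiting time is then again exponential. Averaging this factor
  -- over `p.1` gives `r / (r + s)`.
  have hinner : ∀ᵐ p ∂((expMeasure r).prod X),
      ∫⁻ z, (Prod.map (fun p : ℝ × (ℕ → ℝ) => consSeq p.1 p.2)
          (fun p : ℝ × (ℕ → ℝ) => consSeq p.1 p.2) ⁻¹'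
          {p : (ℕ → ℝ) × (ℕ → ℝ) | p.1 0 < p.2 0 ∧
            ((fun i => p.1 (i + 1), consSeq (p.2 0 - p.1 0) fun i => p.2 (i + 1)) :
              (ℕ → ℝ) × (ℕ → ℝ)) ∈ A}).indicator 1 (p, z) ∂((expMeasure s).prod Y) =
        ENNReal.ofReal (Real.exp (-(s * p.1))) * Y {y | (p.2, y) ∈ A} := by
    filter_upwards [Measure.quasiMeasurePreserving_fst.ae (ae_pos_expMeasure r)] with p hp
    have hm' := (measurable_one (α := ℝ≥0∞).indicator (hcm hmeas)).comp
      (measurable_prodMk_left (x := p))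
    refine (lintegral_prod_symm _ hm'.aemeasurable).trans ?_
    rw [hsec, ← lintegral_const_mul]
    · refine lintegral_congr fun y => ?_
      have hf : Measurable fun b => A.indicator (1 : (ℕ → ℝ) × (ℕ → ℝ) → ℝ≥0∞)
          (p.2, consSeq b y) :=
        (measurable_one.indicator hA).comp (measurable_const.prodMk
          (measurable_consSeq_tail measurable_id measurable_const))
      rw [← lintegral_expMeasure_residual s hp.le hf]
      refine lintegral_congr fun b => ?_
      by_cases hb : p.1 < b
      · rw [Set.indicator_of_mem (show b ∈ Set.Ioi p.1 from hb)]
        by_cases h : (p.2, consSeq (b - p.1) y) ∈ A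
        · rw [Set.indicator_of_mem h]
          refine Set.indicator_of_mem ?_ _
          exact ⟨hb, h⟩
        · rw [Set.indicator_of_notMem h]
          refine Set.indicator_of_notMem ?_ _
          exact fun h' => h h'.2
      · simp [Set.indicator, hb]
    · have hm : Measurable fun z : (ℕ → ℝ) × ℝ => A.indicator
          (1 : (ℕ → ℝ) × (ℕ → ℝ) → ℝ≥0∞) (p.2, consSeq z.2 z.1) :=
        (measurable_one.indicator hA).comp (measurable_const.prodMk
          (measurable_consSeq_tail measurable_snd measurable_fst))
      exact hm.lintegral_prod_right'
  rw [lintegral_congr_ae hinner, 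
    lintegral_prod_mul (f := fun a => ENNReal.ofReal (Real.exp (-(s * a))))
      (g := fun x => Y {y | (x, y) ∈ A}) (by fun_prop) hG.aemeasurable,
    lintegral_exp_neg_expMeasure hr hs]

theorem raceLaw_raceStep_of_lt {r s : ℝ} (hr : 0 < r) (hs : 0 < s)
    {A : Set ((ℕ → ℝ) × (ℕ → ℝ))} (hA : MeasurableSet A) :
    (raceLaw r s).real {p | p.1 0 < p.2 0 ∧ raceStep p ∈ A} =
      r / (r + s) * (raceLaw r s).real A := by
  have h := raceLaw_first_lt hr hs hA
  rw [Measure.real, Measure.real, ← ENNReal.toReal_ofReal (r := r / (r + s)) (by positivity),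
    ← ENNReal.toReal_mul, ← h]
  congr 2
  ext p
  refine and_congr_right fun hp => ?_
  simp only [raceStep, hp, if_true]

/-- Follows from the other case by swapping the processes; ties, which `raceStep` credits to the
second process, are null. -/
theorem raceLaw_raceStep_of_not_lt {r s : ℝ} (hr : 0 < r) (hs : 0 < s)
    {A : Set ((ℕ → ℝ) × (ℕ → ℝ))} (hA : MeasurableSet A) :
    (raceLaw r s).real {p | ¬ p.1 0 < p.2 0 ∧ raceStep p ∈ A} =
      s / (r + s) * (raceLaw r s).real A := by
  have hA' : MeasurableSet (Prod.swap ⁻¹' A) := measurable_swap hA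
  have h := raceLaw_first_lt hs hr hA'
  have hset : MeasurableSet {p : (ℕ → ℝ) × (ℕ → ℝ) | p.1 0 < p.2 0 ∧
      ((fun i => p.1 (i + 1), consSeq (p.2 0 - p.1 0) fun i => p.2 (i + 1)) :
        (ℕ → ℝ) × (ℕ → ℝ)) ∈ Prod.swap ⁻¹' A} :=
    measurableSet_first_lt.inter (measurable_residual hA')
  rw [← raceLaw_swap hr hs, Measure.map_apply measurable_swap hset,
    Measure.map_apply measurable_swap hA', ← Set.preimage_comp, Prod.swap_swap_eq,
    Set.preimage_id, add_comm] at h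
  rw [Measure.real, Measure.real, ← ENNReal.toReal_ofReal (r := s / (r + s)) (by positivity),
    ← ENNReal.toReal_mul, ← h]
  congr 1
  refine measure_congr ?_
  have htie : ∀ᵐ p ∂(raceLaw r s), p.1 0 ≠ p.2 0 := by
    rw [ae_iff]
    simpa using raceLaw_tie hr hs
  filter_upwards [htie] with p hp
  refine propext ⟨fun ⟨h1, h2⟩ => ⟨lt_of_le_of_ne (not_lt.1 h1) hp.symm, ?_⟩,
    fun ⟨h1, h2⟩ => ⟨not_lt.2 (le_of_lt h1), ?_⟩⟩
  · simp only [raceStep, h1, if_false] at h2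
    exact h2
  · have h1' : ¬ p.1 0 < p.2 0 := not_lt.2 (le_of_lt h1)
    simp only [raceStep, h1', if_false]
    exact h2

/-! ### The probability of avoiding long runs -/

/-- There is no `m` with `l[m] = some k` such that `k` arrivals of the second process in a row
directly follow upon arrival number `m` of the first process. -/
def noRun (l : List (Option ℕ)) : Set ((ℕ → ℝ) × (ℕ → ℝ)) :=
  {p | ∀ m k : ℕ, l[m]? = some (some k) → ∀ n, ¬ (firstCount n p = m ∧ firstCount (n + k) p = m)}

theorem measurableSet_noRun (l : List (Option ℕ)) : MeasurableSet (noRun l) := by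
  have : noRun l = ⋂ (m : ℕ) (k : ℕ) (_ : l[m]? = some (some k)) (n : ℕ),
      (firstCount n ⁻¹' {m} ∩ firstCount (n + k) ⁻¹' {m})ᶜ := by
    ext p
    simp [noRun]
  rw [this]
  exact MeasurableSet.iInter fun m => MeasurableSet.iInter fun k => MeasurableSet.iInter fun _ =>
    MeasurableSet.iInter fun n => ((measurable_firstCount n (measurableSet_singleton m)).inter
      (measurable_firstCount (n + k) (measurableSet_singleton m))).compl

theorem raceStep_mem_noRun_of_lt {o : Option ℕ} {l : List (Option ℕ)} {p : (ℕ → ℝ) × (ℕ → ℝ)}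
    (hp : p ∈ noRun (o :: l)) (h : p.1 0 < p.2 0) : raceStep p ∈ noRun l := by
  rintro m k hm n ⟨h1, h2⟩
  refine hp (m + 1) k (by simpa using hm) (n + 1) ⟨?_, ?_⟩
  · rw [firstCount_succ_of_lt h, h1]
  · rw [add_right_comm, firstCount_succ_of_lt h, h2]

theorem raceStep_mem_noRun_none {l : List (Option ℕ)} {p : (ℕ → ℝ) × (ℕ → ℝ)}
    (hp : p ∈ noRun (none :: l)) (h : ¬ p.1 0 < p.2 0) : raceStep p ∈ noRun (none :: l) := by
  rintro m k hm n ⟨h1, h2⟩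
  refine hp m k hm (n + 1) ⟨?_, ?_⟩
  · rw [firstCount_succ_of_not_lt h, h1]
  · rw [add_right_comm, firstCount_succ_of_not_lt h, h2]

/-- An arrival of the second process uses up one unit of the run to be avoided. A run at count `0`
can be taken to start at stage `0`, since the count is monotone; prefixed by that arrival, it has
length `j + 1`. -/
theorem raceStep_mem_noRun_some {j : ℕ} {l : List (Option ℕ)} {p : (ℕ → ℝ) × (ℕ → ℝ)}
    (hp : p ∈ noRun (some (j + 1) :: l)) (h : ¬ p.1 0 < p.2 0) :
    raceStep p ∈ noRun (some j :: l) := by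
  rintro m k hm n ⟨h1, h2⟩
  cases m with
  | zero =>
    simp only [List.getElem?_cons_zero, Option.some.injEq] at hm
    subst hm
    refine hp 0 (j + 1) (by simp) 0 ⟨rfl, ?_⟩
    rw [zero_add, firstCount_succ_of_not_lt h]
    exact Nat.le_zero.1 (h2 ▸ monotone_firstCount (raceStep p) (Nat.le_add_left j n))
  | succ m =>
    refine hp (m + 1) k (by simpa using hm) (n + 1) ⟨?_, ?_⟩
    · rw [firstCount_succ_of_not_lt h, h1]
    · rw [add_right_comm, firstCount_succ_of_not_lt h, h2]

/-- Condition on the next arrival: one of the first process drops the head of the list, one of the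
second lowers the head by one. For a head `k + 1` this gives the factor `(1 - q) + q * (1 - q ^ k) =
1 - q ^ (k + 1)`. -/
theorem raceLaw_noRun_le {r s : ℝ} (hr : 0 < r) (hs : 0 < s) (l : List (Option ℕ)) :
    (raceLaw r s).real (noRun l) ≤
      (l.map fun o => o.elim 1 fun k => 1 - (s / (r + s)) ^ k).prod := by
  have := isProbabilityMeasure_raceLaw hr hs
  have hrs : 0 < r + s := by positivity
  set q := s / (r + s) with hq
  have hq1 : r / (r + s) = 1 - q := by rw [hq]; field_simp; ring
  have hq0 : 0 < q := by positivity
  have hq2 : 0 < 1 - q := by rw [← hq1]; positivity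
  have hstep : ∀ {A B C : Set ((ℕ → ℝ) × (ℕ → ℝ))}, MeasurableSet B → MeasurableSet C →
      (∀ p ∈ A, p.1 0 < p.2 0 → raceStep p ∈ B) → (∀ p ∈ A, ¬ p.1 0 < p.2 0 → raceStep p ∈ C) →
      (raceLaw r s).real A ≤ (1 - q) * (raceLaw r s).real B + q * (raceLaw r s).real C := by
    intro A B C hB hC h1 h2
    rw [← hq1, ← raceLaw_raceStep_of_lt hr hs hB, ← raceLaw_raceStep_of_not_lt hr hs hC]
    refine (measureReal_mono fun p hp => ?_).trans (measureReal_union_le _ _)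
    by_cases h : p.1 0 < p.2 0
    · exact Or.inl ⟨h, h1 p hp h⟩
    · exact Or.inr ⟨h, h2 p hp h⟩
  induction l with
  | nil => simp
  | cons o l ih =>
    rw [List.map_cons, List.prod_cons]
    cases o with
    | none =>
      have h := hstep (measurableSet_noRun l) (measurableSet_noRun (none :: l))
        (fun p hp => raceStep_mem_noRun_of_lt hp) fun p hp => raceStep_mem_noRun_none hp
      have : (raceLaw r s).real (noRun (none :: l)) ≤ (raceLaw r s).real (noRun l) := by nlinarith
      simpa using this.trans ih
    | some k =>
      have key : (raceLaw r s).real (noRun (some k :: l)) ≤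
          (1 - q ^ k) * (raceLaw r s).real (noRun l) := by
        clear ih
        induction k with
        | zero =>
          have : noRun (some 0 :: l) = ∅ :=
            Set.eq_empty_iff_forall_notMem.2 fun p hp => hp 0 0 (by simp) 0 ⟨rfl, rfl⟩
          simp [this]
        | succ k ih =>
          have h := hstep (measurableSet_noRun l) (measurableSet_noRun (some k :: l))
            (fun p hp => raceStep_mem_noRun_of_lt hp) fun p hp => raceStep_mem_noRun_some hp
          have := mul_le_mul_of_nonneg_left ih hq0.le
          rw [pow_succ]
          linarith
      refine key.trans (mul_le_mul_of_nonneg_left ih ?_)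
      have : q ^ k ≤ 1 := pow_le_one₀ hq0.le (by linarith)
      linarith

/-- Second Borel–Cantelli argument: avoiding all runs at the `m ∈ J` below `N` has probability at
most `∏ (1 - q ^ k m) ≤ exp (-∑ q ^ k m)`, which tends to zero with `N`. -/
theorem ae_exists_run {r s : ℝ} (hr : 0 < r) (hs : 0 < s) (J : Set ℕ) (k : ℕ → ℕ)
    (hJ : ¬ Summable (J.indicator fun m => (s / (r + s)) ^ k m)) :
    ∀ᵐ p ∂(raceLaw r s), ∃ m ∈ J, ∃ n, firstCount n p = m ∧ firstCount (n + k m) p = m := by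
  classical
  have := isProbabilityMeasure_raceLaw hr hs
  have hrs : 0 < r + s := by positivity
  set q := s / (r + s) with hq
  have hq0 : 0 < q := by positivity
  let l : ℕ → List (Option ℕ) := fun N =>
    (List.range N).map fun m => if m ∈ J then some (k m) else none
  have hsub : ∀ N, {p | ¬ ∃ m ∈ J, ∃ n, firstCount n p = m ∧ firstCount (n + k m) p = m} ⊆
      noRun (l N) := by
    rintro N p hp m j hm n ⟨h1, h2⟩
    simp only [l, List.getElem?_map, Option.map_eq_some_iff] at hm
    obtain ⟨m', hm', hm⟩ := hm
    rw [List.getElem?_eq_some_iff] at hm'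
    obtain ⟨hlt, hm'⟩ := hm'
    rw [List.getElem_range] at hm'
    subst hm'
    split_ifs at hm with hmJ
    simp only [Option.some.injEq] at hm
    subst hm
    exact hp ⟨m, hmJ, n, h1, h2⟩
  have hbound : ∀ N, (raceLaw r s).real (noRun (l N)) ≤
      Real.exp (-∑ m ∈ Finset.range N, J.indicator (fun m => q ^ k m) m) := by
    intro N
    refine (raceLaw_noRun_le hr hs (l N)).trans ?_
    rw [← Finset.sum_neg_distrib, Real.exp_sum, List.map_map, ← hq,
      Finset.prod_eq_multiset_prod, Finset.range_val, ← Multiset.coe_range, Multiset.map_coe,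
      Multiset.prod_coe]
    have hq1 : q ≤ 1 := by rw [hq, div_le_one hrs]; linarith
    have hqk : ∀ j, q ^ j ≤ 1 := fun j => pow_le_one₀ hq0.le hq1
    refine List.prod_map_le_prod_map₀ _ _ (fun m _ => ?_) fun m _ => ?_
    · by_cases hm : m ∈ J <;> simp [hm, hqk]
    · by_cases hm : m ∈ J
      · simpa [hm, sub_eq_neg_add] using Real.add_one_le_exp (-q ^ k m)
      · simp [hm]
  have htend : Tendsto (fun N => Real.exp (-∑ m ∈ Finset.range N, J.indicator (fun m => q ^ k m) m))
      atTop (nhds 0) := by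
    refine Real.tendsto_exp_atBot.comp (tendsto_neg_atTop_atBot.comp ?_)
    refine (not_summable_iff_tendsto_nat_atTop_of_nonneg fun m => ?_).1 hJ
    exact Set.indicator_nonneg (fun m _ => by positivity) m
  rw [ae_iff]
  have hzero : (raceLaw r s).real
      {p | ¬ ∃ m ∈ J, ∃ n, firstCount n p = m ∧ firstCount (n + k m) p = m} ≤ 0 :=
    ge_of_tendsto' htend fun N => (measureReal_mono (hsub N)).trans (hbound N)
  rw [← measureReal_eq_zero_iff]
  exact le_antisymm hzero measureReal_nonneg

end Race

/-! ### The forking adversary -/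

/-- The chain of the first `m` blocks of a mining process. -/
def prefixChain (u : ℕ → Block) (m : ℕ) : Chain := List.ofFn fun i : Fin m => u i

@[simp] theorem length_prefixChain (u : ℕ → Block) (m : ℕ) : (prefixChain u m).length = m := by
  simp [prefixChain]

@[simp] theorem size_prefixChain (u : ℕ → Block) (m : ℕ) : (prefixChain u m).size = m + 1 := by
  simp [Chain.size]

theorem getElem?_prefixChain (u : ℕ → Block) {m i : ℕ} (hi : i < m) :
    (prefixChain u m)[i]? = some (u i) := by
  simp [prefixChain, hi]

theorem prefixChain_succ (u : ℕ → Block) (m : ℕ) :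
    prefixChain u (m + 1) = prefixChain u m ++ [u m] := by
  simp only [prefixChain, List.ofFn_succ', List.concat_eq_append]
  rfl

/-- The adversary forks right before the trimming point of the honest chain after every honest
block, extends the fork by its own blocks as long as no honest block is mined, and broadcasts
nothing. -/
noncomputable def forkStrategy (T : TrimmingProtocol) : Strategy where
  parent s :=
    match s.history with
    | [] => s.chain
    | b :: _ => if b.byAdversary then b.chain else s.chain.take ((T.trim s.chain).trimPoint - 1)
  broadcast s := s.chain

theorem run_forkStrategy_succ (T : TrimmingProtocol) (ξ ζ : Mining) (n : ℕ) :
    run (forkStrategy T) ξ ζ (n + 1) =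
      mine (forkStrategy T) ξ ζ (run (forkStrategy T) ξ ζ n) := by
  simp [run, deliver, forkStrategy]

/-- The interarrival times of two mining processes. -/
def times (ξ ζ : Mining) : (ℕ → ℝ) × (ℕ → ℝ) := (fun i => (ξ i).1, fun i => (ζ i).1)

section Run

variable (T : TrimmingProtocol) (ξ ζ : Mining)

theorem tree_subset_mine (σ : Strategy) (s : State) : s.tree ⊆ (mine σ ξ ζ s).tree := by
  rintro D (rfl | ⟨b, hb, rfl⟩)
  · exact Or.inl rfl
  · refine Or.inr ⟨b, ?_, rfl⟩
    unfold mine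
    split_ifs <;> exact List.mem_cons_of_mem _ hb

/-- Nothing is broadcast, so the honest chain consists of all honest blocks, and the execution
follows the race of the mining times alone. -/
theorem run_forkStrategy_counts (n : ℕ) :
    (run (forkStrategy T) ξ ζ n).honestMined = firstCount n (times ξ ζ) ∧
    (run (forkStrategy T) ξ ζ n).advMined = n - firstCount n (times ξ ζ) ∧
    (run (forkStrategy T) ξ ζ n).chain =
      prefixChain (fun i => (ξ i).2) (firstCount n (times ξ ζ)) := by
  induction n with
  | zero => simp [run, State.init, firstCount, prefixChain]
  | succ n ih =>
    obtain ⟨h1, h2, h3⟩ := ih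
    have hle := firstCount_le n (times ξ ζ)
    rw [run_forkStrategy_succ, firstCount_succ, mine, h1, h2, h3]
    by_cases h : arrivalTime (times ξ ζ).1 (firstCount n (times ξ ζ)) <
      arrivalTime (times ξ ζ).2 (n - firstCount n (times ξ ζ))
    · have h' : arrival ξ (firstCount n (times ξ ζ)) <
        arrival ζ (n - firstCount n (times ξ ζ)) := h
      rw [if_pos h, if_pos h', prefixChain_succ]
      exact ⟨rfl, by dsimp only; omega, rfl⟩
    · have h' : ¬ arrival ξ (firstCount n (times ξ ζ)) <
        arrival ζ (n - firstCount n (times ξ ζ)) := h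
      rw [if_neg h, if_neg h', add_zero]
      exact ⟨rfl, by dsimp only; omega, rfl⟩

theorem run_forkStrategy_of_firstCount_succ_eq_add_one {n : ℕ}
    (h : firstCount (n + 1) (times ξ ζ) = firstCount n (times ξ ζ) + 1) :
    (run (forkStrategy T) ξ ζ (n + 1)).history =
      ⟨arrival ξ (firstCount n (times ξ ζ)), false,
        prefixChain (fun i => (ξ i).2) (firstCount (n + 1) (times ξ ζ))⟩ ::
        (run (forkStrategy T) ξ ζ n).history := by
  obtain ⟨h1, h2, h3⟩ := run_forkStrategy_counts T ξ ζ n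
  rw [firstCount_succ, Nat.add_left_cancel_iff] at h
  have h' : arrival ξ (firstCount n (times ξ ζ)) < arrival ζ (n - firstCount n (times ξ ζ)) := by
    by_contra hn
    rw [if_neg (show ¬ arrivalTime (times ξ ζ).1 _ < arrivalTime (times ξ ζ).2 _ from hn)] at h
    exact zero_ne_one h
  rw [run_forkStrategy_succ, mine, h1, h2, h3, if_pos h', firstCount_succ, h, prefixChain_succ]

theorem run_forkStrategy_of_firstCount_succ_eq {n : ℕ}
    (h : firstCount (n + 1) (times ξ ζ) = firstCount n (times ξ ζ))
    (ht : (forkStrategy T).parent (run (forkStrategy T) ξ ζ n) ∈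
      (run (forkStrategy T) ξ ζ n).tree) :
    (run (forkStrategy T) ξ ζ (n + 1)).history =
      ⟨arrival ζ (n - firstCount n (times ξ ζ)), true,
        (forkStrategy T).parent (run (forkStrategy T) ξ ζ n) ++
          [(ζ (n - firstCount n (times ξ ζ))).2]⟩ :: (run (forkStrategy T) ξ ζ n).history := by
  obtain ⟨h1, h2, h3⟩ := run_forkStrategy_counts T ξ ζ n
  have h' : ¬ arrival ξ (firstCount n (times ξ ζ)) < arrival ζ (n - firstCount n (times ξ ζ)) := by
    intro hn
    rw [firstCount_succ,
      if_pos (show arrivalTime (times ξ ζ).1 _ < arrivalTime (times ξ ζ).2 _ from hn)] at h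
    exact Nat.succ_ne_self _ h
  rw [run_forkStrategy_succ, mine, h1, h2, if_neg h', if_pos ht]

/-- Ensures that the fork point is a legitimate parent; otherwise `mine` would fall back on the
honest chain. -/
theorem prefixChain_mem_tree (n j : ℕ) (hj : j ≤ firstCount n (times ξ ζ)) :
    prefixChain (fun i => (ξ i).2) j ∈ (run (forkStrategy T) ξ ζ n).tree := by
  induction n with
  | zero =>
    obtain rfl : j = 0 := by simpa [firstCount] using hj
    exact Or.inl (by simp [prefixChain])
  | succ n ih =>
    by_cases h : j ≤ firstCount n (times ξ ζ)
    · rw [run_forkStrategy_succ]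
      exact tree_subset_mine _ _ _ _ (ih h)
    · have hs : firstCount (n + 1) (times ξ ζ) = firstCount n (times ξ ζ) + 1 := by
        have := firstCount_succ n (times ξ ζ)
        split_ifs at this <;> omega
      obtain rfl : j = firstCount (n + 1) (times ξ ζ) := by omega
      rw [State.tree, run_forkStrategy_of_firstCount_succ_eq_add_one T ξ ζ hs]
      exact Or.inr ⟨_, List.mem_cons_self, rfl⟩

theorem take_prefixChain (u : ℕ → Block) {i m : ℕ} (h : i ≤ m) :
    (prefixChain u m).take i = prefixChain u i := by
  refine List.ext_getElem? fun j => ?_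
  rw [List.getElem?_take]
  split_ifs with hj
  · rw [getElem?_prefixChain u (hj.trans_le h), getElem?_prefixChain u hj]
  · rw [List.getElem?_eq_none]
    simpa using hj

/-- While only adversary blocks are mined after an honest block, they form a fork. -/
theorem fork_growth {n m k : ℕ} (hn : firstCount n (times ξ ζ) + 1 = m)
    (h1 : firstCount (n + 1) (times ξ ζ) = m) (h2 : firstCount (n + 1 + k) (times ξ ζ) = m) :
    ∀ j ≤ k, ∃ D : Chain, D = prefixChain (fun i => (ξ i).2)
        ((T.trim (prefixChain (fun i => (ξ i).2) m)).trimPoint - 1) ++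
          prefixChain (fun i => (ζ (n + 1 - m + i)).2) j ∧
      (forkStrategy T).parent (run (forkStrategy T) ξ ζ (n + 1 + j)) = D ∧
      D ∈ (run (forkStrategy T) ξ ζ (n + 1 + j)).tree := by
  have hconst : ∀ j ≤ k, firstCount (n + 1 + j) (times ξ ζ) = m := fun j hj =>
    le_antisymm (h2 ▸ monotone_firstCount (times ξ ζ) (Nat.add_le_add_left hj _))
      (h1 ▸ monotone_firstCount (times ξ ζ) (Nat.le_add_right _ _))
  have hlt := (T.trim (prefixChain (fun i => (ξ i).2) m)).trimPoint_lt
  rw [T.chain_trim, size_prefixChain] at hlt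
  intro j
  induction j with
  | zero =>
    intro _
    -- The last block is honest, so the strategy resets to the fork point. Entry `i` of the list has
    -- index `i + 1`, so keeping `trimPoint - 1` entries gives the first fork block the index
    -- `trimPoint`, when this is positive.
    refine ⟨_, rfl, ?_, ?_⟩
    · have hh := run_forkStrategy_of_firstCount_succ_eq_add_one T ξ ζ (n := n) (h1.trans hn.symm)
      obtain ⟨-, -, h3⟩ := run_forkStrategy_counts T ξ ζ (n + 1)
      rw [h1] at h3
      simp only [add_zero, forkStrategy] at hh h3 ⊢
      rw [hh]
      simp only [h3, Bool.false_eq_true, if_false]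
      rw [take_prefixChain _ (by omega)]
      simp [prefixChain]
    · have := prefixChain_mem_tree T ξ ζ (n + 1)
        ((T.trim (prefixChain (fun i => (ξ i).2) m)).trimPoint - 1) (by omega)
      simpa [prefixChain] using this
  | succ j ih =>
    intro hj
    obtain ⟨D, hD, hp, ht⟩ := ih (by omega)
    have hc := hconst j (by omega)
    have hc' : firstCount (n + 1 + j + 1) (times ξ ζ) = firstCount (n + 1 + j) (times ξ ζ) :=
      (hconst (j + 1) hj).trans hc.symm
    have hh := run_forkStrategy_of_firstCount_succ_eq T ξ ζ hc' (hp.symm ▸ ht)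
    have hle := firstCount_le (n + 1) (times ξ ζ)
    rw [hp, hc] at hh
    refine ⟨_, rfl, ?_, ?_⟩
    · rw [prefixChain_succ, ← List.append_assoc, ← hD,
        show n + 1 - m + j = n + 1 + j - m by omega, ← add_assoc]
      change (match (run (forkStrategy T) ξ ζ (n + 1 + j + 1)).history with
        | [] => _
        | b :: _ => _) = _
      rw [hh]
      rfl
    · refine Or.inr ⟨_, by rw [← add_assoc, hh]; exact List.mem_cons_self, ?_⟩
      rw [prefixChain_succ, ← List.append_assoc, ← hD,
        show n + 1 - m + j = n + 1 + j - m by omega]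

/-- The fork has `trimPoint - 1 + k` blocks after genesis, which exceeds `m` exactly when `k`
exceeds the tail length `m + 1 - trimPoint`. It leaves the honest chain at index `trimPoint` because
the hashes there differ. -/
theorem trimAttacked_of_run {n m k : ℕ} (hne : ∀ i j, (ξ i).2 ≠ (ζ j).2) (hm : 0 < m)
    (hB : 0 < (T.trim (prefixChain (fun i => (ξ i).2) m)).trimPoint)
    (hk : (T.trim (prefixChain (fun i => (ξ i).2) m)).tailLength < k)
    (h1 : firstCount n (times ξ ζ) = m) (h2 : firstCount (n + k) (times ξ ζ) = m) :
    TrimAttacked T (forkStrategy T) ξ ζ := by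
  classical
  have hex : ∃ n, firstCount n (times ξ ζ) = m := ⟨n, h1⟩
  -- The stage `n` may lie anywhere within the run. The fork starts when honest block `m` is mined,
  -- so the run is moved back to the first stage with count `m`.
  obtain ⟨n', hn'⟩ : ∃ n', Nat.find hex = n' + 1 := by
    refine Nat.exists_eq_succ_of_ne_zero fun h0 => ?_
    have := Nat.find_spec hex
    rw [h0] at this
    exact hm.ne this
  have hf1 : firstCount (n' + 1) (times ξ ζ) = m := hn' ▸ Nat.find_spec hex
  have hf0 : firstCount n' (times ξ ζ) ≠ m := Nat.find_min hex (by omega)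
  have hle : n' + 1 ≤ n := hn' ▸ Nat.find_min' hex h1
  have hf2 : firstCount (n' + 1 + k) (times ξ ζ) = m :=
    le_antisymm (h2 ▸ monotone_firstCount (times ξ ζ) (Nat.add_le_add_right hle _))
      (hf1 ▸ monotone_firstCount (times ξ ζ) (Nat.le_add_right _ _))
  have hf : firstCount n' (times ξ ζ) + 1 = m := by
    have := firstCount_succ n' (times ξ ζ)
    split_ifs at this <;> omega
  obtain ⟨D, hD, -, ht⟩ := fork_growth T ξ ζ hf hf1 hf2 k le_rfl
  obtain ⟨-, -, hchain⟩ := run_forkStrategy_counts T ξ ζ (n' + 1 + k)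
  rw [hf2] at hchain
  refine ⟨n' + 1 + k, Or.inl ⟨D, ht, ?_, ?_⟩⟩
  all_goals rw [hchain]
  all_goals
    set C := prefixChain (fun i => (ξ i).2) m with hC
    have hlt := (T.trim C).trimPoint_lt
    rw [T.chain_trim, hC, size_prefixChain, ← hC] at hlt
  · unfold lca
    rw [Finset.sup_lt_iff hB]
    intro i hi
    rw [Finset.mem_filter, T.chain_trim, T.chain_trim] at hi
    by_contra hcon
    have hB' : (T.trim C).trimPoint ≤ i := not_lt.1 hcon
    -- A common block of index at least `trimPoint` would force agreement at entry `trimPoint - 1`,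
    -- where one chain has an honest block and the other the first fork block.
    have h := congrArg (fun L : List Block => L[(T.trim C).trimPoint - 1]?) hi.2
    simp only [List.getElem?_take] at h
    have hBi : (T.trim C).trimPoint - 1 < i := by omega
    have hk0 : 0 < k := by omega
    rw [if_pos hBi, if_pos hBi, hC, getElem?_prefixChain _ (by rw [← hC]; omega), ← hC, hD,
      List.getElem?_append_right (by simp), length_prefixChain, Nat.sub_self,
      getElem?_prefixChain _ hk0] at h
    exact hne _ _ (Option.some.inj h)
  · unfold compare
    rw [if_pos]
    rw [T.chain_trim, T.chain_trim, hD]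
    unfold TrimmedChain.tailLength at hk
    rw [T.chain_trim, hC, size_prefixChain, ← hC] at hk
    simp only [Chain.size, List.length_append, length_prefixChain, hC]
    rw [← hC]
    omega

end Run

/-! ### The time between two blocks -/

section Times

open scoped ENNReal

/-- The law of the interarrival times of a Poisson process. -/
noncomputable abbrev timesLaw (r : ℝ) : Measure (ℕ → ℝ) :=
  Measure.infinitePi fun _ : ℕ => expMeasure r

/-- The time from which on the process has at least `m` arrivals. -/
def startTime (x : ℕ → ℝ) (m : ℕ) : ℝ := ∑ i ∈ Finset.range m, x i

/-- The process has exactly `m` arrivals up to time `t`. -/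
def sojourn (m : ℕ) (t : ℝ) : Set (ℕ → ℝ) := {x | startTime x m ≤ t ∧ t < startTime x (m + 1)}

theorem measurable_startTime (m : ℕ) : Measurable fun x => startTime x m := by
  unfold startTime
  fun_prop

theorem measurableSet_uncurry_sojourn (m : ℕ) :
    MeasurableSet {p : ℝ × (ℕ → ℝ) | p.2 ∈ sojourn m p.1} :=
  (measurableSet_le ((measurable_startTime m).comp measurable_snd) measurable_fst).inter
    (measurableSet_lt measurable_fst ((measurable_startTime (m + 1)).comp measurable_snd))

theorem measurableSet_sojourn (m : ℕ) (t : ℝ) : MeasurableSet (sojourn m t) :=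
  measurable_prodMk_left (measurableSet_uncurry_sojourn m)

variable {r : ℝ}

theorem ae_pos_timesLaw (hr : 0 < r) : ∀ᵐ x ∂(timesLaw r), ∀ i, 0 < x i := by
  have := isProbabilityMeasure_expMeasure hr
  exact ae_all_iff.2 fun i =>
    (measurePreserving_eval_infinitePi (fun _ : ℕ => expMeasure r) i).quasiMeasurePreserving.ae
      (ae_pos_expMeasure r)

/-- The expected length of a sojourn. -/
theorem lintegral_sojourn (hr : 0 < r) (m : ℕ) :
    ∫⁻ t, timesLaw r (sojourn m t) = ∫⁻ x, ENNReal.ofReal x ∂(expMeasure r) := by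
  have := isProbabilityMeasure_expMeasure hr
  have hS := measurableSet_uncurry_sojourn m
  have h1 := Measure.prod_apply (μ := (volume : Measure ℝ)) (ν := timesLaw r) hS
  have h2 := Measure.prod_apply_symm (μ := (volume : Measure ℝ)) (ν := timesLaw r) hS
  have h3 := (measurePreserving_eval_infinitePi (fun _ : ℕ => expMeasure r) m).lintegral_comp
    ENNReal.measurable_ofReal
  rw [← h3]
  -- Tonelli: for fixed interarrival times, the times with exactly `m` arrivals form an interval of
  -- length `x m`.
  refine (h1.symm.trans h2).trans (lintegral_congr fun x => ?_)
  have : (fun t => (t, x)) ⁻¹' {p : ℝ × (ℕ → ℝ) | p.2 ∈ sojourn m p.1} =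
      Set.Ico (startTime x m) (startTime x (m + 1)) := rfl
  rw [this, Real.volume_Ico, startTime, startTime, Finset.sum_range_succ, add_sub_cancel_left]

theorem lintegral_ofReal_expMeasure_ne_top (hr : 0 < r) :
    ∫⁻ x, ENNReal.ofReal x ∂(expMeasure r) ≠ ∞ := by
  refine ((lintegral_mono fun x => ?_).trans_lt (integrable_expMeasure hr).2).ne
  exact Real.ofReal_le_enorm x

/-- The strong law of large numbers; only the positivity of the mean matters, so it is not computed.
-/
theorem exists_tendsto_startTime_div (hr : 0 < r) :
    ∃ c > 0, ∀ᵐ x ∂(timesLaw r), Tendsto (fun n : ℕ => startTime x n / n) atTop (nhds c) := by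
  have := isProbabilityMeasure_expMeasure hr
  have hmp := fun i => measurePreserving_eval_infinitePi (fun _ : ℕ => expMeasure r) i
  have hint : Integrable (fun x : ℕ → ℝ => x 0) (timesLaw r) :=
    ((hmp 0).integrable_comp (g := id) (by fun_prop)).2 (integrable_expMeasure hr)
  refine ⟨∫ x, x 0 ∂(timesLaw r), ?_, ?_⟩
  · rw [gt_iff_lt, integral_pos_iff_support_of_nonneg_ae _ hint]
    · refine pos_iff_ne_zero.2 fun h => ?_
      have h0 : ∀ᵐ x ∂(timesLaw r), x 0 = 0 := by
        rw [ae_iff]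
        exact h
      obtain ⟨x, hx, hx'⟩ := (h0.and (ae_pos_timesLaw hr)).exists
      exact (hx' 0).ne' hx
    · filter_upwards [ae_pos_timesLaw hr] with x hx using (hx 0).le
  · have hind := iIndepFun_infinitePi (P := fun _ : ℕ => expMeasure r)
      (X := fun _ (y : ℝ) => y) fun _ => measurable_id
    have hident : ∀ i, IdentDistrib (fun x : ℕ → ℝ => x i) (fun x : ℕ → ℝ => x 0)
        (timesLaw r) (timesLaw r) := fun i =>
      ⟨(measurable_pi_apply i).aemeasurable, (measurable_pi_apply 0).aemeasurable, by
        rw [Measure.infinitePi_map_eval, Measure.infinitePi_map_eval]⟩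
    exact strong_law_ae_real (μ := timesLaw r) (fun i x => x i) hint
      (fun i j hij => hind.indepFun hij) hident

theorem ae_tendsto_startTime (hr : 0 < r) :
    ∀ᵐ x ∂(timesLaw r), Tendsto (fun n => startTime x n) atTop atTop := by
  obtain ⟨c, hc, h⟩ := exists_tendsto_startTime_div hr
  filter_upwards [h] with x hx
  refine (hx.pos_mul_atTop hc tendsto_natCast_atTop_atTop).congr' ?_
  filter_upwards [eventually_ne_atTop 0] with n hn
  exact div_mul_cancel₀ _ (Nat.cast_ne_zero.2 hn)

/-- Arrival number `N ^ 2` comes at a time of order `N ^ 2`, far beyond `N`. This crude cutoff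
suffices, since the sum of the `a m` up to `N ^ 2` will still be `o(N)`. -/
theorem tendsto_startTime_sq_le (hr : 0 < r) :
    Tendsto (fun N : ℕ => (timesLaw r).real {x | startTime x (N ^ 2) ≤ N}) atTop (nhds 0) := by
  have := isProbabilityMeasure_expMeasure hr
  obtain ⟨c, hc, h⟩ := exists_tendsto_startTime_div hr
  have hm := tendstoInMeasure_of_tendsto_ae (μ := timesLaw r)
    (f := fun (n : ℕ) x => startTime x n / n) (g := fun _ => c)
    (fun n => ((measurable_startTime n).div_const _).aestronglyMeasurable) h
  rw [tendstoInMeasure_iff_measureReal_norm] at hm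
  have h2 := (hm (c / 2) (by positivity)).comp
    (tendsto_pow_atTop (α := ℕ) two_ne_zero)
  refine tendsto_of_tendsto_of_tendsto_of_le_of_le' tendsto_const_nhds h2
    (Eventually.of_forall fun N => measureReal_nonneg) ?_
  obtain ⟨N₀, hN₀⟩ := exists_nat_ge (2 / c)
  filter_upwards [eventually_ge_atTop N₀, eventually_gt_atTop 0] with N hN hN'
  refine measureReal_mono fun x hx => ?_
  have hx : startTime x (N ^ 2) ≤ N := hx
  have hNpos : (0 : ℝ) < N := by exact_mod_cast hN'
  have hcN : 2 / c ≤ N := hN₀.trans (by exact_mod_cast hN)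
  rw [div_le_iff₀ hc] at hcN
  have h3 : startTime x (N ^ 2) / ((N ^ 2 : ℕ) : ℝ) ≤ c / 2 := by
    rw [div_le_iff₀ (by positivity)]
    push_cast
    nlinarith
  simp only [Set.mem_ofPred_eq, Real.norm_eq_abs]
  rw [abs_of_nonpos (by linarith)]
  linarith

/-- A function `φ` of time, which is bounded by the chance that the present number of arrivals
belongs to a random sparse set of numbers, is not bounded away from zero. -/
theorem not_eventually_le_of_sojourn_bound (hr : 0 < r) {a : ℕ → ℝ} (ha : ∀ m, 0 ≤ a m)
    (hsparse : Tendsto (fun N : ℕ => (∑ m ∈ Finset.range (N ^ 2), a m) / N) atTop (nhds 0))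
    {φ : ℝ → ℝ}
    (hφ : ∀ t, 0 ≤ t → ∀ M : ℕ, φ t ≤ ∑ m ∈ Finset.range M, a m * (timesLaw r).real (sojourn m t) +
      (timesLaw r).real {x | startTime x M ≤ t})
    {c : ℝ} (hc : 0 < c) : ¬ ∀ᶠ t in atTop, c ≤ φ t := by
  intro hev
  have := isProbabilityMeasure_expMeasure hr
  obtain ⟨t₀, ht₀⟩ := eventually_atTop.1 hev
  set t₁ := max t₀ 0 with ht₁
  set L := (∫⁻ x, ENNReal.ofReal x ∂(expMeasure r)).toReal with hL
  have hLtop := lintegral_ofReal_expMeasure_ne_top hr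
  -- Integrate `hφ` with `M = N ^ 2` over `[t₁, N]`: each sojourn has expected total length `L`, and
  -- the late-arrival event is largest at `t = N`.
  have hkey : ∀ N : ℕ, t₁ ≤ N → c * (N - t₁) ≤ (∑ m ∈ Finset.range (N ^ 2), a m) * L +
      N * (timesLaw r).real {x | startTime x (N ^ 2) ≤ N} := by
    intro N hN
    have hle : ∫⁻ _ in Set.Icc t₁ (N : ℝ), ENNReal.ofReal c ≤
        ∫⁻ t in Set.Icc t₁ (N : ℝ), (∑ m ∈ Finset.range (N ^ 2),
          ENNReal.ofReal (a m) * timesLaw r (sojourn m t) +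
            timesLaw r {x | startTime x (N ^ 2) ≤ N}) := by
      refine setLIntegral_mono' measurableSet_Icc fun t ht => ?_
      have h0 : 0 ≤ t := (le_max_right _ _).trans ht.1
      have h1 := (ht₀ t ((le_max_left _ _).trans ht.1)).trans (hφ t h0 (N ^ 2))
      refine (ENNReal.ofReal_le_ofReal h1).trans ?_
      rw [ENNReal.ofReal_add (Finset.sum_nonneg fun m _ => mul_nonneg (ha m) measureReal_nonneg)
        measureReal_nonneg, ENNReal.ofReal_sum_of_nonneg fun m _ =>
          mul_nonneg (ha m) measureReal_nonneg, ofReal_measureReal]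
      gcongr with m
      · rw [ENNReal.ofReal_mul (ha m), ofReal_measureReal]
      · exact ht.2
    have hms : ∀ m, Measurable fun t => timesLaw r (sojourn m t) := fun m =>
      measurable_measure_prodMk_left (measurableSet_uncurry_sojourn m)
    rw [setLIntegral_const, Real.volume_Icc, ← ENNReal.ofReal_mul hc.le,
      lintegral_add_right _ measurable_const, setLIntegral_const, Real.volume_Icc,
      lintegral_finsetSum _ fun m _ => (hms m).const_mul _] at hle
    have hle2 : ENNReal.ofReal (c * (N - t₁)) ≤ ENNReal.ofReal
        ((∑ m ∈ Finset.range (N ^ 2), a m) * L +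
          N * (timesLaw r).real {x | startTime x (N ^ 2) ≤ N}) := by
      refine hle.trans ?_
      rw [ENNReal.ofReal_add (mul_nonneg (Finset.sum_nonneg fun m _ => ha m)
        ENNReal.toReal_nonneg) (by positivity), Finset.sum_mul, ENNReal.ofReal_sum_of_nonneg
          fun m _ => mul_nonneg (ha m) ENNReal.toReal_nonneg, mul_comm (N : ℝ),
        ENNReal.ofReal_mul measureReal_nonneg, ofReal_measureReal]
      gcongr with m
      · rw [lintegral_const_mul _ (hms m), ENNReal.ofReal_mul (ha m),
          ENNReal.ofReal_toReal hLtop, ← lintegral_sojourn hr m]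
        gcongr
        exact Measure.restrict_le_self
      · exact sub_le_self _ (le_max_right _ _)
    refine (ENNReal.ofReal_le_ofReal_iff ?_).1 hle2
    exact add_nonneg (mul_nonneg (Finset.sum_nonneg fun m _ => ha m) ENNReal.toReal_nonneg)
      (by positivity)
  have hlim : Tendsto (fun N : ℕ => (∑ m ∈ Finset.range (N ^ 2), a m) / N * L +
      (timesLaw r).real {x | startTime x (N ^ 2) ≤ N} + c * t₁ / N) atTop (nhds 0) := by
    simpa using ((hsparse.mul_const L).add (tendsto_startTime_sq_le hr)).add
      (tendsto_const_div_atTop_nhds_zero_nat (c * t₁))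
  have hc' : c ≤ 0 := by
    refine ge_of_tendsto hlim ?_
    obtain ⟨N₁, hN₁⟩ := exists_nat_ge t₁
    filter_upwards [eventually_ge_atTop N₁, eventually_gt_atTop 0] with N hN hN'
    have hNpos : (0 : ℝ) < N := by exact_mod_cast hN'
    have h := hkey N (hN₁.trans (by exact_mod_cast hN))
    rw [div_mul_eq_mul_div, ← sub_nonneg]
    have h2 : (∑ m ∈ Finset.range (N ^ 2), a m) * L / N +
        (timesLaw r).real {x | startTime x (N ^ 2) ≤ N} + c * t₁ / N - c =
        ((∑ m ∈ Finset.range (N ^ 2), a m) * L +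
          N * (timesLaw r).real {x | startTime x (N ^ 2) ≤ N} - c * (N - t₁)) / N := by
      field_simp
      ring
    rw [h2]
    exact div_nonneg (by linarith) hNpos.le
  exact absurd hc (not_lt.2 hc')

/-- For large `m < N ^ 2` the weight `p m` is at least `κ / √N`, so the weighted bound `K` allows
the `a m` a sum of at most `K * √N / κ`, up to finitely many terms. -/
theorem tendsto_sum_range_sq_div {a p : ℕ → ℝ} (ha : ∀ m, 0 ≤ a m) (ha1 : ∀ m, a m ≤ 1)
    (hp0 : ∀ m, 0 ≤ p m) {K κ : ℝ} (hK : ∀ N, ∑ m ∈ Finset.range N, p m * a m ≤ K) (hκ : 0 < κ)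
    (hp : ∀ᶠ m : ℕ in atTop, κ ≤ p m * √√((m : ℝ) + 1)) :
    Tendsto (fun N : ℕ => (∑ m ∈ Finset.range (N ^ 2), a m) / N) atTop (nhds 0) := by
  obtain ⟨m₀, hm₀⟩ := eventually_atTop.1 hp
  have hbound : ∀ N : ℕ, ∑ m ∈ Finset.range (N ^ 2), a m ≤ m₀ + K * √N / κ := by
    intro N
    have hterm : ∀ m ∈ Finset.range (N ^ 2),
        a m ≤ (if m < m₀ then 1 else 0) + p m * a m * (√N / κ) := by
      intro m hm
      have hpa : 0 ≤ p m * a m * (√N / κ) :=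
        mul_nonneg (mul_nonneg (hp0 m) (ha m)) (by positivity)
      split_ifs with h
      · linarith [ha1 m]
      · have hmN : (m : ℝ) + 1 ≤ N ^ 2 := by exact_mod_cast Finset.mem_range.1 hm
        have h1 : √√((m : ℝ) + 1) ≤ √N :=
          Real.sqrt_le_sqrt (Real.sqrt_le_iff.2 ⟨by positivity, hmN⟩)
        have h2 : κ ≤ p m * √N :=
          (hm₀ m (not_lt.1 h)).trans (mul_le_mul_of_nonneg_left h1 (hp0 m))
        have h3 : p m * a m * (√N / κ) = a m * (p m * √N / κ) := by ring
        rw [zero_add, h3]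
        exact le_mul_of_one_le_right (ha m) ((one_le_div hκ).2 h2)
    refine (Finset.sum_le_sum hterm).trans ?_
    rw [Finset.sum_add_distrib, ← Finset.sum_mul]
    refine add_le_add ?_ ?_
    · rw [Finset.sum_ite, Finset.sum_const_zero, add_zero, Finset.sum_const, nsmul_one]
      have : (Finset.range (N ^ 2)).filter (· < m₀) ⊆ Finset.range m₀ := fun m hm =>
        Finset.mem_range.2 (Finset.mem_filter.1 hm).2
      exact_mod_cast (Finset.card_le_card this).trans_eq (Finset.card_range m₀)
    · rw [← mul_div_assoc]
      have := mul_le_mul_of_nonneg_right (hK (N ^ 2)) (Real.sqrt_nonneg N)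
      gcongr
  have hlim : Tendsto (fun N : ℕ => (m₀ : ℝ) / N + K / κ * (√N)⁻¹) atTop (nhds 0) := by
    have h1 : Tendsto (fun N : ℕ => (√(N : ℝ))⁻¹) atTop (nhds 0) :=
      tendsto_inv_atTop_zero.comp (Real.tendsto_sqrt_atTop.comp tendsto_natCast_atTop_atTop)
    simpa using (tendsto_const_div_atTop_nhds_zero_nat (m₀ : ℝ)).add (h1.const_mul (K / κ))
  refine tendsto_of_tendsto_of_tendsto_of_le_of_le' tendsto_const_nhds hlim
    (Eventually.of_forall fun N => div_nonneg (Finset.sum_nonneg fun m _ => ha m) N.cast_nonneg) ?_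
  filter_upwards [eventually_gt_atTop 0] with N hN
  have hNpos : (0 : ℝ) < N := by exact_mod_cast hN
  have hs : 0 < √(N : ℝ) := Real.sqrt_pos.2 hNpos
  rw [div_le_iff₀ hNpos]
  refine (hbound N).trans_eq ?_
  have hsq : √(N : ℝ) * √N = N := Real.mul_self_sqrt hNpos.le
  rw [add_mul, div_mul_cancel₀ _ hNpos.ne', mul_assoc (K / κ)]
  congr 1
  nth_rw 3 [← hsq]
  field_simp

end Times

/-! ### The sequence of the hashes -/

section Hashes

open scoped ENNReal symmDiff

/-- The law of the hashes of the blocks. -/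
noncomputable abbrev hashLaw : Measure (ℕ → Block) := Measure.infinitePi fun _ : ℕ => volume

/-- The interarrival times and the hashes of a mining process. -/
def unzip (ξ : Mining) : (ℕ → ℝ) × (ℕ → Block) := (fun i => (ξ i).1, fun i => (ξ i).2)

theorem measurable_unzip : Measurable unzip := by
  unfold unzip
  fun_prop

theorem measurePreserving_unzip {r : ℝ} (hr : 0 < r) :
    MeasurePreserving unzip (miningLaw r) ((timesLaw r).prod hashLaw) := by
  have := isProbabilityMeasure_expMeasure hr
  exact ⟨measurable_unzip, infinitePi_prod_map_unzip _ _⟩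

theorem miningLaw_real_inter {r : ℝ} (hr : 0 < r) {A : Set (ℕ → ℝ)} {F : Set (ℕ → Block)}
    (hA : MeasurableSet A) (hF : MeasurableSet F) :
    (miningLaw r).real (unzip ⁻¹' A ×ˢ F) = (timesLaw r).real A * hashLaw.real F := by
  have := isProbabilityMeasure_expMeasure hr
  rw [(measurePreserving_unzip hr).measureReal_preimage (hA.prod hF).nullMeasurableSet,
    measureReal_prod_prod]

theorem ae_count_eq {r : ℝ} (hr : 0 < r) :
    ∀ᵐ ξ ∂(miningLaw r), ∀ t, 0 ≤ t → (unzip ξ).1 ∈ sojourn (count ξ t) t := by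
  have := isProbabilityMeasure_expMeasure hr
  have h1 : ∀ᵐ p ∂((timesLaw r).prod hashLaw), (∀ i, 0 < p.1 i) ∧
      Tendsto (fun n => startTime p.1 n) atTop atTop :=
    Measure.quasiMeasurePreserving_fst.ae ((ae_pos_timesLaw hr).and (ae_tendsto_startTime hr))
  filter_upwards [(measurePreserving_unzip hr).quasiMeasurePreserving.ae h1] with ξ hξ t ht
  obtain ⟨hpos, htend⟩ := hξ
  set x := (unzip ξ).1 with hx
  have hmono : StrictMono fun n => startTime x n := strictMono_nat_of_lt_succ fun n => by
    simp only [startTime, Finset.sum_range_succ]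
    linarith [hpos n]
  have hex : ∃ m, t < startTime x (m + 1) :=
    ((htend.comp (tendsto_add_atTop_nat 1)).eventually_gt_atTop t).exists
  classical
  -- `ncard` is `0` on infinite sets, so `count` is meaningful only because the arrival times tend
  -- to infinity; being increasing, they make this set an initial segment.
  have hset : {n | arrival ξ n ≤ t} = ((Finset.range (Nat.find hex) : Finset ℕ) : Set ℕ) := by
    ext n
    simp only [Set.mem_ofPred_eq, Finset.coe_range, Set.mem_Iio]
    constructor
    · intro h
      by_contra hn
      have h2 : startTime x (Nat.find hex + 1) ≤ startTime x (n + 1) :=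
        hmono.monotone (by omega)
      have h3 : startTime x (n + 1) ≤ t := h
      linarith [Nat.find_spec hex]
    · intro h
      exact not_lt.1 (Nat.find_min hex h)
  have hc : count ξ t = Nat.find hex := by
    rw [count, hset, Set.ncard_coe_finset, Finset.card_range]
  rw [hc]
  refine ⟨?_, Nat.find_spec hex⟩
  rcases Nat.eq_zero_or_eq_succ_pred (Nat.find hex) with h0 | h0
  · rw [h0]
    simpa [startTime] using ht
  · have := Nat.find_min hex (m := (Nat.find hex).pred) (by omega)
    rw [h0]
    exact not_lt.1 this

/-- The trimmed chain of `m` blocks (and the genesis block) has a tail of length at most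
`h (m + 1)`. -/
def shortAt (T : TrimmingProtocol) (h : ℕ → ℝ) (m : ℕ) : Set (ℕ → Block) :=
  {u | ((T.trim (prefixChain u m)).tailLength : ℝ) ≤ h (m + 1)}

theorem measurable_trimPoint_prefixChain (T : TrimmingProtocol) (m : ℕ) :
    Measurable fun u : ℕ → Block => (T.trim (prefixChain u m)).trimPoint :=
  (T.measurable_trimPoint m).comp (f := fun (u : ℕ → Block) (i : Fin m) => u i) (by fun_prop)

theorem measurableSet_shortAt (T : TrimmingProtocol) (h : ℕ → ℝ) (m : ℕ) :
    MeasurableSet (shortAt T h m) := by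
  have : Measurable fun u : ℕ → Block => ((T.trim (prefixChain u m)).tailLength : ℝ) := by
    simp only [TrimmedChain.tailLength, T.chain_trim, size_prefixChain]
    exact (measurable_of_countable fun j : ℕ => ((m + 1 - j : ℕ) : ℝ)).comp
      (measurable_trimPoint_prefixChain T m)
  exact measurableSet_le this measurable_const

/-! ### Recurrence of short tails -/

/-- Every event about the hashes of positive probability has a probability near one, given a
suitable event about the first hashes. -/
theorem exists_beginsIn_approx {E : Set (ℕ → Block)} (hE : MeasurableSet E) {δ : ℝ} (hδ : 0 < δ) :
    ∃ (n : ℕ) (S : Set (Fin n → Block)), MeasurableSet S ∧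
      hashLaw.real {u | (fun i : Fin n => u i) ∈ S ∧ u ∉ E} ≤ δ ∧
      hashLaw.real E - δ ≤ hashLaw.real {u | (fun i : Fin n => u i) ∈ S} := by
  obtain ⟨F, hF, hFE⟩ := exists_measure_symmDiff_lt_of_generateFrom_isSetRing (μ := hashLaw)
    isSetRing_measurableCylinders ⟨{Set.univ}, Set.countable_singleton _,
      by
        simpa using univ_mem_measurableCylinders fun _ : ℕ => Block, by simp⟩
    generateFrom_measurableCylinders.symm hE (ENNReal.ofReal_pos.2 hδ)
  rw [measurableCylinders_nat] at hF
  simp only [Set.mem_iUnion, Set.mem_singleton_iff] at hF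
  obtain ⟨a, S, hS, rfl⟩ := hF
  have hreal : hashLaw.real (cylinder (Finset.Iic a) S ∆ E) ≤ δ :=
    ENNReal.toReal_le_of_le_ofReal hδ.le hFE.le
  have hg : Measurable fun (v : Fin (a + 1) → Block) (i : Finset.Iic a) =>
      v ⟨i, Nat.lt_succ_of_le (Finset.mem_Iic.1 i.2)⟩ := by fun_prop
  refine ⟨a + 1, _, hg hS, ?_, ?_⟩
  · refine (measureReal_mono ?_).trans hreal
    rintro u ⟨h1, h2⟩
    exact Or.inl ⟨h1, h2⟩
  · change _ ≤ hashLaw.real (cylinder (Finset.Iic a) S)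
    have h1 : hashLaw.real E ≤ hashLaw.real (cylinder (Finset.Iic a) S) +
        hashLaw.real (cylinder (Finset.Iic a) S ∆ E) := by
      refine (measureReal_mono fun u hu => ?_).trans (measureReal_union_le _ _)
      by_cases h : u ∈ cylinder (Finset.Iic a) S
      · exact Or.inl h
      · exact Or.inr (Or.inr ⟨hu, h⟩)
    linarith

theorem lt_measure_shortTail_inter {T : TrimmingProtocol} {r ε : ℝ} {h : ℕ → ℝ} (hr : 0 < r)
    (hε : 0 < ε) (hshort : HasShortTails T r ε h) {E : Set (ℕ → Block)} (hE : MeasurableSet E)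
    (hpos : 0 < hashLaw.real E) :
    ∃ c > 0, ∀ᶠ t in atTop,
      c ≤ (miningLaw r).real ({ξ | (unzip ξ).2 ∈ E} ∩ shortTail T h t) := by
  have := isProbabilityMeasure_expMeasure hr
  have := isProbabilityMeasure_miningLaw hr
  -- The bound `1 / 2` keeps `S` at least half as likely as `E`, so `S` with a short tail has
  -- probability above `ε / 2` times that of `E`; the bound `ε / 4` limits the loss outside `E` to
  -- half of this.
  set η := min (1 / 2) (ε / 4) with hη
  have hη0 : 0 < η := by positivity
  obtain ⟨n, S, hS, h1, h2⟩ := exists_beginsIn_approx hE (mul_pos hη0 hpos)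
  have hSm : MeasurableSet {u : ℕ → Block | (fun i : Fin n => u i) ∈ S} :=
    (show Measurable fun (u : ℕ → Block) (i : Fin n) => u i by fun_prop) hS
  have hpre : ∀ F : Set (ℕ → Block), MeasurableSet F →
      (miningLaw r).real {ξ | (unzip ξ).2 ∈ F} = hashLaw.real F := fun F hF => by
    have := miningLaw_real_inter hr MeasurableSet.univ hF
    rw [probReal_univ, one_mul] at this
    rw [← this]
    congr 1
    ext ξ
    simp
  have hB : (miningLaw r).real (beginsIn S) =
      hashLaw.real {u | (fun i : Fin n => u i) ∈ S} := hpre _ hSm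
  have hη1 : η ≤ 1 / 2 := min_le_left _ _
  have hη2 : η ≤ ε / 4 := min_le_right _ _
  have hBpos : hashLaw.real E / 2 ≤ (miningLaw r).real (beginsIn S) := by
    rw [hB]
    nlinarith
  have hBm : MeasurableSet (beginsIn S : Set Mining) :=
    (show Measurable fun (ξ : Mining) (i : Fin n) => (ξ i).2 by fun_prop) hS
  refine ⟨ε / 4 * hashLaw.real E, by positivity, ?_⟩
  have hne : miningLaw r (beginsIn S) ≠ 0 := fun h0 => by
    have : (miningLaw r).real (beginsIn S) = 0 := by rw [Measure.real, h0, ENNReal.toReal_zero]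
    linarith
  filter_upwards [hshort n S hS hne] with t ht
  rw [Measure.real, cond_apply hBm, ENNReal.toReal_mul, ENNReal.toReal_inv, ← Measure.real,
    ← Measure.real, lt_inv_mul_iff₀ (by linarith)] at ht
  have h3 : (miningLaw r).real (beginsIn S ∩ shortTail T h t) ≤
      (miningLaw r).real {ξ | (unzip ξ).2 ∈ {u | (fun i : Fin n => u i) ∈ S ∧ u ∉ E}} +
        (miningLaw r).real ({ξ | (unzip ξ).2 ∈ E} ∩ shortTail T h t) := by
    refine (measureReal_mono ?_).trans (measureReal_union_le _ _)
    rintro ξ ⟨hξ1, hξ2⟩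
    by_cases hξE : (unzip ξ).2 ∈ E
    · exact Or.inr ⟨hξE, hξ2⟩
    · exact Or.inl ⟨hξ1, hξE⟩
  have hSE : MeasurableSet {u : ℕ → Block | (fun i : Fin n => u i) ∈ S ∧ u ∉ E} :=
    hSm.inter hE.compl
  rw [hpre _ hSE] at h3
  nlinarith

/-- Split by the number `m` of blocks at time `t`. This number depends on the times only, shortness
at a given `m` on the hashes only, so the probabilities multiply; the last term covers `m ≥ M`. -/
theorem measure_shortTail_inter_le {T : TrimmingProtocol} {r : ℝ} {h : ℕ → ℝ} (hr : 0 < r)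
    {E : Set (ℕ → Block)} (hE : MeasurableSet E) {t : ℝ} (ht : 0 ≤ t) (M : ℕ) :
    (miningLaw r).real ({ξ | (unzip ξ).2 ∈ E} ∩ shortTail T h t) ≤
      ∑ m ∈ Finset.range M, hashLaw.real (E ∩ shortAt T h m) * (timesLaw r).real (sojourn m t) +
        (timesLaw r).real {x | startTime x M ≤ t} := by
  have := isProbabilityMeasure_expMeasure hr
  have := isProbabilityMeasure_miningLaw hr
  have hlate := miningLaw_real_inter hr
    (measurableSet_le (measurable_startTime M) (measurable_const (a := t))) MeasurableSet.univ
  rw [probReal_univ, mul_one] at hlate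
  simp_rw [mul_comm (hashLaw.real _), ← miningLaw_real_inter hr (measurableSet_sojourn _ t)
    (hE.inter (measurableSet_shortAt T h _))]
  rw [← hlate]
  refine le_trans ?_ (add_le_add_left (measureReal_biUnion_finset_le _ _) _)
  refine le_trans ?_ (measureReal_union_le _ _)
  refine ENNReal.toReal_mono (measure_ne_top _ _) (measure_mono_ae ?_)
  filter_upwards [ae_count_eq hr, (measurePreserving_unzip hr).quasiMeasurePreserving.ae
    (Measure.quasiMeasurePreserving_fst.ae (ae_pos_timesLaw hr))] with ξ hξ hpos
  rintro ⟨h1, h2⟩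
  by_cases hM : count ξ t < M
  · refine Or.inl (Set.mem_biUnion (Finset.mem_range.2 hM) ⟨hξ t ht, h1, ?_⟩)
    have h2' : ((T.trim (prefixChain (unzip ξ).2 (count ξ t))).tailLength : ℝ) ≤
        h (prefixChain (unzip ξ).2 (count ξ t)).size := h2
    rwa [size_prefixChain] at h2'
  · refine Or.inr ⟨?_, trivial⟩
    refine le_trans ?_ (hξ t ht).1
    exact Finset.sum_le_sum_of_subset_of_nonneg (Finset.range_mono (not_lt.1 hM))
      fun i _ _ => (hpos i).le

theorem sum_mul_hashLaw_le {p : ℕ → ℝ} {G : ℕ → Set (ℕ → Block)} (hG : ∀ m, MeasurableSet (G m))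
    {E : Set (ℕ → Block)} (hE : MeasurableSet E) {K : ℝ} (hK : 0 ≤ K) (N : ℕ)
    (hEK : ∀ u ∈ E, ∑ m ∈ Finset.range N, (G m).indicator (fun _ => p m) u ≤ K) :
    ∑ m ∈ Finset.range N, p m * hashLaw.real (E ∩ G m) ≤ K := by
  have hint : ∀ m, Integrable ((E ∩ G m).indicator fun _ => p m) hashLaw := fun m =>
    (integrable_const _).indicator (hE.inter (hG m))
  have h1 : ∑ m ∈ Finset.range N, p m * hashLaw.real (E ∩ G m) =
      ∫ u, ∑ m ∈ Finset.range N, (E ∩ G m).indicator (fun _ => p m) u ∂hashLaw := by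
    rw [integral_finsetSum _ fun m _ => hint m]
    refine Finset.sum_congr rfl fun m _ => ?_
    rw [integral_indicator_const _ (hE.inter (hG m)), smul_eq_mul, mul_comm]
  rw [h1]
  have h2 : ∫ _, K ∂hashLaw = K := by simp
  rw [← h2]
  refine integral_mono (integrable_finsetSum _ fun m _ => hint m) (integrable_const _) fun u => ?_
  by_cases hu : u ∈ E
  · refine le_trans (le_of_eq ?_) (hEK u hu)
    refine Finset.sum_congr rfl fun m _ => ?_
    by_cases hm : u ∈ G m <;> simp [hu, hm]
  · simpa [hu] using hK

/-- The numbers of blocks at which the tail is short are almost surely not sparse. -/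
theorem ae_not_summable_shortAt {T : TrimmingProtocol} {r ε : ℝ} {h : ℕ → ℝ} (hr : 0 < r)
    (hε : 0 < ε) (hshort : HasShortTails T r ε h) {p : ℕ → ℝ} (hp0 : ∀ m, 0 ≤ p m)
    {κ : ℝ} (hκ : 0 < κ) (hp : ∀ᶠ m : ℕ in atTop, κ ≤ p m * √√((m : ℝ) + 1)) :
    ∀ᵐ u ∂hashLaw, ¬ Summable fun m => (shortAt T h m).indicator (fun _ => p m) u := by
  have hGm := measurableSet_shortAt T h
  -- The sequences with a convergent sum are covered by these countably many events, so it suffices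
  -- that each one is null.
  let E : ℕ → Set (ℕ → Block) := fun K =>
    {u | ∀ N, ∑ m ∈ Finset.range N, (shortAt T h m).indicator (fun _ => p m) u ≤ K}
  have hEm : ∀ K, MeasurableSet (E K) := fun K => by
    have : E K = ⋂ N, {u | ∑ m ∈ Finset.range N,
        (shortAt T h m).indicator (fun _ => p m) u ≤ K} := by
      ext u
      simp [E]
    rw [this]
    exact MeasurableSet.iInter fun N => measurableSet_le
      (Finset.measurable_sum _ fun m _ => measurable_const.indicator (hGm m)) measurable_const
  have hnull : ∀ K, hashLaw (E K) = 0 := by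
    intro K
    by_contra hne
    have hpos : 0 < hashLaw.real (E K) :=
      ENNReal.toReal_pos hne (measure_ne_top _ _)
    obtain ⟨c, hc, hev⟩ := lt_measure_shortTail_inter hr hε hshort (hEm K) hpos
    refine not_eventually_le_of_sojourn_bound hr
      (a := fun m => hashLaw.real (E K ∩ shortAt T h m)) (fun m => measureReal_nonneg)
      (tendsto_sum_range_sq_div (fun m => measureReal_nonneg) (fun m => measureReal_le_one) hp0
        (K := K) (fun N => ?_) hκ hp)
      (fun t ht M => measure_shortTail_inter_le hr (hEm K) ht M) hc hev
    exact sum_mul_hashLaw_le hGm (hEm K) K.cast_nonneg N fun u hu => hu N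
  rw [ae_iff]
  refine measure_mono_null ?_ (measure_iUnion_null hnull)
  intro u hu
  have hu : Summable fun m => (shortAt T h m).indicator (fun _ => p m) u := not_not.1 hu
  obtain ⟨K, hK⟩ := exists_nat_ge (∑' m, (shortAt T h m).indicator (fun _ => p m) u)
  refine Set.mem_iUnion.2 ⟨K, fun N => le_trans (hu.sum_le_tsum _ fun m _ => ?_) hK⟩
  exact Set.indicator_nonneg (fun _ _ => hp0 m) u

end Hashes

/-! ### Conclusion -/

/-- Uniform hashes have no atoms. As blocks are identified with their hashes, this keeps a fork from
coinciding with the honest chain. -/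
theorem ae_hash_ne {r s : ℝ} (hr : 0 < r) (hs : 0 < s) :
    ∀ᵐ ω ∂((miningLaw r).prod (miningLaw s)), ∀ i j, (ω.1 i).2 ≠ (ω.2 j).2 := by
  have := isProbabilityMeasure_expMeasure hs
  have := isProbabilityMeasure_miningLaw hr
  have := isProbabilityMeasure_miningLaw hs
  refine ae_all_iff.2 fun i => ae_all_iff.2 fun j => ?_
  have hm : MeasurableSet {ω : Mining × Mining | (ω.1 i).2 ≠ (ω.2 j).2} :=
    (measurableSet_eq_fun (by fun_prop) (by fun_prop)).compl
  refine (Measure.ae_prod_iff_ae_ae hm).2 (ae_of_all _ fun ξ => ?_)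
  have h1 : ∀ᵐ b ∂((expMeasure s).prod (volume : Measure Block)), (ξ i).2 ≠ b.2 :=
    Measure.quasiMeasurePreserving_snd.ae (by
      filter_upwards [Measure.ae_ne volume (ξ i).2] with b hb using hb.symm)
  exact (measurePreserving_eval_infinitePi
    (fun _ : ℕ => (expMeasure s).prod (volume : Measure Block)) j).quasiMeasurePreserving.ae h1

/-- Independence of the honest hashes from the race lets the short-tailed chain lengths be treated
as a deterministic set. -/
theorem measurePreserving_hashes_times {r s : ℝ} (hr : 0 < r) (hs : 0 < s) :
    MeasurePreserving (fun ω : Mining × Mining => ((unzip ω.1).2, times ω.1 ω.2))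
      ((miningLaw r).prod (miningLaw s)) (hashLaw.prod (raceLaw r s)) := by
  have := isProbabilityMeasure_expMeasure hr
  have := isProbabilityMeasure_expMeasure hs
  have := isProbabilityMeasure_miningLaw hr
  have := isProbabilityMeasure_miningLaw hs
  have h1 : MeasurePreserving (fun ξ => (unzip ξ).swap) (miningLaw r)
      (hashLaw.prod (timesLaw r)) :=
    Measure.measurePreserving_swap.comp (measurePreserving_unzip hr)
  have h2 : MeasurePreserving (fun ζ => (unzip ζ).1) (miningLaw s) (timesLaw s) :=
    measurePreserving_fst.comp (measurePreserving_unzip hs)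
  exact (measurePreserving_prodAssoc hashLaw (timesLaw r) (timesLaw s)).comp (h1.prod h2)

/-- A run of `k m` adversary blocks almost surely follows upon some honest block number `m` which
completes a short-tailed chain. -/
theorem ae_exists_run_shortAt {T : TrimmingProtocol} {r s : ℝ} {h : ℕ → ℝ} (hr : 0 < r)
    (hs : 0 < s) (k : ℕ → ℕ) (m₀ : ℕ)
    (hsum : ∀ᵐ u ∂hashLaw,
      ¬ Summable fun m => (shortAt T h m).indicator (fun _ => (s / (r + s)) ^ k m) u) :
    ∀ᵐ ω ∂((miningLaw r).prod (miningLaw s)), ∃ m ≥ m₀, (unzip ω.1).2 ∈ shortAt T h m ∧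
      ∃ n, firstCount n (times ω.1 ω.2) = m ∧ firstCount (n + k m) (times ω.1 ω.2) = m := by
  have := isProbabilityMeasure_raceLaw hr hs
  have hm : MeasurableSet {z : (ℕ → Block) × ((ℕ → ℝ) × (ℕ → ℝ)) | ∃ m ≥ m₀,
      z.1 ∈ shortAt T h m ∧ ∃ n, firstCount n z.2 = m ∧ firstCount (n + k m) z.2 = m} := by
    have : {z : (ℕ → Block) × ((ℕ → ℝ) × (ℕ → ℝ)) | ∃ m ≥ m₀,
        z.1 ∈ shortAt T h m ∧ ∃ n, firstCount n z.2 = m ∧ firstCount (n + k m) z.2 = m} =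
        ⋃ (m : ℕ) (_ : m ≥ m₀), shortAt T h m ×ˢ
          ⋃ n, firstCount n ⁻¹' {m} ∩ firstCount (n + k m) ⁻¹' {m} := by
      ext z
      simp
      exact exists_congr fun n => and_left_comm
    rw [this]
    exact MeasurableSet.iUnion fun m => MeasurableSet.iUnion fun _ =>
      (measurableSet_shortAt T h m).prod (MeasurableSet.iUnion fun n =>
        (measurable_firstCount n (measurableSet_singleton m)).inter
          (measurable_firstCount (n + k m) (measurableSet_singleton m)))
  refine (measurePreserving_hashes_times hr hs).quasiMeasurePreserving.ae
    ((Measure.ae_prod_iff_ae_ae hm).2 ?_)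
  filter_upwards [hsum] with u hu
  have hJ : ¬ Summable ({m | m₀ ≤ m ∧ u ∈ shortAt T h m}.indicator
      fun m => (s / (r + s)) ^ k m) := by
    refine fun hc => hu ?_
    rw [← summable_nat_add_iff m₀] at hc ⊢
    refine hc.congr fun m => ?_
    by_cases hmu : u ∈ shortAt T h (m + m₀) <;> simp [hmu]
  filter_upwards [ae_exists_run hr hs _ k hJ] with p hp
  obtain ⟨m, ⟨h1, h2⟩, h3⟩ := hp
  exact ⟨m, h1, h2, h3⟩

theorem eventually_le_pow_mul_sqrt {h : ℕ → ℝ} (hh : h =o[atTop] fun B : ℕ => Real.log B)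
    {q : ℝ} (hq0 : 0 < q) (hq1 : q < 1) :
    ∀ᶠ m : ℕ in atTop, q ≤ q ^ (⌊h (m + 1)⌋₊ + 1) * √√((m : ℝ) + 1) := by
  have hlog : Real.log q < 0 := Real.log_neg hq0 hq1
  -- With this constant, `q ^ ⌊h (m + 1)⌋₊` is at least `(m + 1) ^ (-1/4)`, which the double square
  -- root cancels.
  have hδ : 0 < (-4 * Real.log q)⁻¹ := inv_pos.2 (by linarith)
  have hev := (tendsto_add_atTop_nat 1).eventually (hh.bound hδ)
  filter_upwards [hev] with m hm
  push_cast at hm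
  have hm1 : (0 : ℝ) < (m : ℝ) + 1 := by positivity
  have hl0 : 0 ≤ Real.log ((m : ℝ) + 1) := 
    Real.log_nonneg (by linarith [(m.cast_nonneg : (0 : ℝ) ≤ m)])
  rw [Real.norm_eq_abs, Real.norm_eq_abs, abs_of_nonneg hl0] at hm
  have hfloor : (⌊h (m + 1)⌋₊ : ℝ) ≤ (-4 * Real.log q)⁻¹ * Real.log ((m : ℝ) + 1) := by
    refine le_trans ?_ hm
    rcases le_total 0 (h (m + 1)) with h0 | h0
    · exact (Nat.floor_le h0).trans (le_abs_self _)
    · rw [Nat.floor_of_nonpos h0]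
      simp
  have hsqrt : √√((m : ℝ) + 1) = Real.exp (Real.log ((m : ℝ) + 1) * (1 / 4)) := by
    rw [← Real.rpow_def_of_pos hm1, Real.sqrt_eq_rpow, Real.sqrt_eq_rpow,
      ← Real.rpow_mul hm1.le]
    norm_num
  have hpow : q ^ ⌊h (m + 1)⌋₊ = Real.exp (⌊h (m + 1)⌋₊ * Real.log q) := by
    rw [Real.exp_nat_mul, Real.exp_log hq0]
  rw [pow_succ, mul_right_comm, hsqrt, hpow, ← Real.exp_add]
  refine le_mul_of_one_le_left hq0.le (Real.one_le_exp ?_)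
  have h2 := mul_le_mul_of_nonneg_right hfloor (by linarith : 0 ≤ -4 * Real.log q)
  rw [mul_right_comm, inv_mul_cancel₀ (by linarith : (-4 * Real.log q) ≠ 0), one_mul] at h2
  linarith

/-- With trimming point `0` the tail is the whole chain, and its length `m + 1` would be at most
`log (m + 1) ≤ m`. -/
theorem eventually_trimPoint_pos (T : TrimmingProtocol) {h : ℕ → ℝ}
    (hh : h =o[atTop] fun B : ℕ => Real.log B) :
    ∀ᶠ m : ℕ in atTop, ∀ u ∈ shortAt T h m, 0 < (T.trim (prefixChain u m)).trimPoint := by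
  have hev := (tendsto_add_atTop_nat 1).eventually (hh.bound one_pos)
  filter_upwards [hev] with m hm u hu
  by_contra h0
  have h0 : (T.trim (prefixChain u m)).trimPoint = 0 := by omega
  have hu : ((T.trim (prefixChain u m)).tailLength : ℝ) ≤ h (m + 1) := hu
  rw [TrimmedChain.tailLength, T.chain_trim, size_prefixChain, h0, Nat.sub_zero] at hu
  have hm1 : (0 : ℝ) < ((m + 1 : ℕ) : ℝ) := by positivity
  have hl0 : 0 ≤ Real.log ((m + 1 : ℕ) : ℝ) := Real.log_natCast_nonneg _
  rw [Real.norm_eq_abs, Real.norm_eq_abs, abs_of_nonneg hl0, one_mul] at hm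
  linarith [le_abs_self (h (m + 1)), Real.log_le_sub_one_of_pos hm1]

end HybridNode

theorem theorem4 (T : HybridNode.TrimmingProtocol) (lamH : ℝ) (hlamH : 0 < lamH)
    (ε : ℝ) (hε : 0 < ε) (h : ℕ → ℝ) (hh : h =o[atTop] fun B : ℕ => Real.log B)
    (hshort : HybridNode.HasShortTails T lamH ε h) :
    ∃ lamA : ℝ, 0 < lamA ∧ lamA < lamH ∧ ∃ σ : HybridNode.Strategy,
      ∀ᵐ ω ∂((HybridNode.miningLaw lamH).prod (HybridNode.miningLaw lamA)),
        HybridNode.TrimAttacked T σ ω.1 ω.2 := by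
  open HybridNode in
  have hA : 0 < lamH / 2 := half_pos hlamH
  -- The choice is arbitrary: any rate strictly between `0` and `lamH` would serve.
  refine ⟨lamH / 2, hA, half_lt_self hlamH, forkStrategy T, ?_⟩
  have hq0 : 0 < lamH / 2 / (lamH + lamH / 2) := by positivity
  have hq1 : lamH / 2 / (lamH + lamH / 2) < 1 := by
    rw [div_lt_one (by positivity)]
    linarith
  obtain ⟨m₀, hm₀⟩ := eventually_atTop.1 (eventually_trimPoint_pos T hh)
  have hsum := ae_not_summable_shortAt hlamH hε hshort (fun m => (pow_pos hq0 _).le) hq0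
    (eventually_le_pow_mul_sqrt hh hq0 hq1)
  filter_upwards [ae_hash_ne hlamH hA,
    ae_exists_run_shortAt hlamH hA (fun m => ⌊h (m + 1)⌋₊ + 1) (max m₀ 1) hsum] with ω hne hω
  obtain ⟨m, hm, hu, n, h1, h2⟩ := hω
  exact trimAttacked_of_run T ω.1 ω.2 hne (lt_of_lt_of_le one_pos ((le_max_right _ _).trans hm))
    (hm₀ m ((le_max_left _ _).trans hm) _ hu) (Nat.lt_succ_of_le (Nat.le_floor hu)) h1 h2
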